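/- All graphs are finite and simple. For a connected graph \(G\), let \(d(v)\) be the degree of the vertex \(v\) and let \(R(u,v)\) be the resistance distance, that is, the effective resistance between \(u\) and \(v\) when every edge of \(G\) is replaced by a unit resistor. The degree resistance distance of \(G\) is \[D_R(G)=\sum_{\{u,v\}\subseteq V(G)}\bigl(d(u)+d(v)\bigr)R(u,v).\] A cactus is a connected graph each of whose blocks (maximal connected subgraphs without cut vertices) is an edge or a cycle, and \(\mathrm{Cact}(n,t)\) denotes the set of cacti with \(n\) vertices and \(t\) cycles. Let \(G^0(n,t)\), for \(n\ge 2t+1\), be the graph consisting of \(t\) triangles and \(n-2t-1\) pendent edges that all share one common vertex. Let \(G_5\), for \(t\ge 1\) and \(n\ge 2t+2\), be the graph consisting of one 4-cycle, \(t-1\) triangles and \(n-2t-2\) pendent edges that all share one common vertex. **Corollary 4.2.** Let \(n\ge 7\) and \(t\ge 1\), and let \(G\in \mathrm{Cact}(n,t)\) be not isomorphic to \(G^0(n,t)\). Then \[D_R(G)\ \ge\ -\tfrac43t^2+\Bigl(\tfrac43n-\tfrac{13}3\Bigr)t+3n^2-\tfrac{16}3n-\tfrac{19}3,\] with equality if and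 only if \(n\ge 2t+2\) and \(G\cong G_5\). (If \(n=2t+1\), the graph \(G_5\) does not exist and the inequality is strict.) -/

import Mathlib

namespace DegreeResistance

section Resistance

variable {V : Type*} [Fintype V]

open Classical in
/-- Put a unit resistor on every edge of `G`. The function `φ` is a potential on the nodes which,
by the laws of Ohm and Kirchhoff, drives one unit of current into the network at `u` and out of it
at `v`: at every node `w` the net current `∑_{x ~ w} (φ w - φ x)` is `[w = u] - [w = v]`. The matrix
`G.lapMatrix ℝ` is the Laplacian of `G`. -/
def IsUnitPotential (G : SimpleGraph V) (u v : V) (φ : V → ℝ) : Prop :=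
  (G.lapMatrix ℝ).mulVec φ = Pi.single u 1 - Pi.single v 1

open Classical in
/-- The resistance distance `R_G(u, v)`: the potential difference between `u` and `v` when one unit
of current flows from `u` to `v`, every edge being a unit resistor. It exists whenever `G` is
connected (`exists_isUnitPotential`), and it does not depend on the potential chosen
(`resistance_eq`). -/
noncomputable def resistance (G : SimpleGraph V) (u v : V) : ℝ :=
  if h : ∃ φ, IsUnitPotential G u v φ then h.choose u - h.choose v else 0

theorem IsUnitPotential.sub_eq_sub {G : SimpleGraph V} {u v : V} {φ ψ : V → ℝ}
    (hφ : IsUnitPotential G u v φ) (hψ : IsUnitPotential G u v ψ) : φ u - φ v = ψ u - ψ v := by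
  classical
  unfold IsUnitPotential at hφ hψ
  have key : φ ⬝ᵥ (G.lapMatrix ℝ).mulVec ψ = ψ ⬝ᵥ (G.lapMatrix ℝ).mulVec φ := by
    rw [Matrix.dotProduct_mulVec, ← Matrix.mulVec_transpose, (G.isSymm_lapMatrix (R := ℝ)).eq,
      dotProduct_comm]
  have h1 : φ ⬝ᵥ (Pi.single u 1 - Pi.single v 1) = ψ ⬝ᵥ (Pi.single u 1 - Pi.single v 1) := by
    convert key using 2
    · exact hψ.symm
    · exact hφ.symm
  simpa [dotProduct_sub] using h1

theorem resistance_eq {G : SimpleGraph V} {u v : V} {φ : V → ℝ} (hφ : IsUnitPotential G u v φ) :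
    resistance G u v = φ u - φ v := by
  have h : ∃ φ, IsUnitPotential G u v φ := ⟨φ, hφ⟩
  rw [resistance, dif_pos h]
  exact h.choose_spec.sub_eq_sub hφ

theorem exists_isUnitPotential {G : SimpleGraph V} (hG : G.Connected) (u v : V) :
    ∃ φ, IsUnitPotential G u v φ := by
  classical
  have hne : Nonempty V := hG.nonempty
  have hcard : (Fintype.card V : ℝ) ≠ 0 := by exact_mod_cast Fintype.card_ne_zero
  have hsum : ∀ x : V → ℝ, ∑ w, (G.lapMatrix ℝ).mulVec x w = 0 := by
    intro x
    have h0 : (G.lapMatrix ℝ).mulVec (fun _ => 1) = 0 := G.lapMatrix_mulVec_const_eq_zero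
    have : (fun _ : V => (1 : ℝ)) ⬝ᵥ (G.lapMatrix ℝ).mulVec x = 0 := by
      rw [Matrix.dotProduct_mulVec, ← Matrix.mulVec_transpose, (G.isSymm_lapMatrix (R := ℝ)).eq, h0,
        zero_dotProduct]
    simpa [dotProduct] using this
  let T : (V → ℝ) →ₗ[ℝ] (V → ℝ) :=
    { toFun := fun x w => (G.lapMatrix ℝ).mulVec x w + ∑ y, x y
      map_add' := fun x y => by
        ext w; simp [Matrix.mulVec_add, Finset.sum_add_distrib]; ring
      map_smul' := fun c x => by
        ext w; simp [Matrix.mulVec_smul, Finset.mul_sum, mul_add] }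
  have hT : ∀ x w, T x w = (G.lapMatrix ℝ).mulVec x w + ∑ y, x y := fun _ _ => rfl
  have hTsum : ∀ x, ∑ w, T x w = Fintype.card V * ∑ y, x y := by
    intro x
    simp [hT, Finset.sum_add_distrib, hsum]
  have hinj : Function.Injective T := by
    rw [injective_iff_map_eq_zero]
    intro x hx
    have h1 : ∑ y, x y = 0 := by
      have := hTsum x
      rw [hx] at this
      simpa [hcard] using this.symm
    have h2 : (G.lapMatrix ℝ).mulVec x = 0 := by
      ext w
      have := congrFun hx w
      simpa [hT, h1] using this
    rw [SimpleGraph.lapMatrix_mulVec_eq_zero_iff_forall_reachable] at h2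
    ext w
    have h3 : ∑ y, x y = Fintype.card V * x w := by
      rw [Finset.sum_congr rfl (fun y _ => h2 y w (hG.preconnected y w))]
      simp
    rw [h1] at h3
    simpa [hcard] using h3.symm
  obtain ⟨φ, hφ⟩ := (LinearMap.injective_iff_surjective.mp hinj)
    (Pi.single u 1 - Pi.single v 1 : V → ℝ)
  have h1 : ∑ y, φ y = 0 := by
    have := hTsum φ
    rw [hφ] at this
    simpa [hcard, Finset.sum_sub_distrib] using this.symm
  refine ⟨φ, ?_⟩
  unfold IsUnitPotential
  ext w
  have h2 := congrFun hφ w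
  rw [hT, h1, add_zero] at h2
  convert h2 using 2

open Classical in
/-- The degree resistance distance `D_R(G) = ∑_{{u, v} ⊆ V(G)} (d(u) + d(v)) R(u, v)`. The sum over
unordered pairs is half of the sum over ordered pairs; the pairs with `u = v` contribute `0`. -/
noncomputable def degreeResistance (G : SimpleGraph V) : ℝ :=
  (∑ u, ∑ v, ((G.degree u : ℝ) + (G.degree v : ℝ)) * resistance G u v) / 2

end Resistance

section Cactus

variable {V : Type*}

/-- The subgraph `H` of `G` is a single edge with its two ends. -/
def IsEdgeSubgraph {G : SimpleGraph V} (H : G.Subgraph) : Prop :=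
  ∃ (u v : V) (h : G.Adj u v), H = G.subgraphOfAdj h

/-- The subgraph `H` of `G` is a cycle. -/
def IsCycleSubgraph {G : SimpleGraph V} (H : G.Subgraph) : Prop :=
  ∃ (u : V) (c : G.Walk u u), c.IsCycle ∧ H = c.toSubgraph

/-- The subgraph `H` is connected and has no cut vertex: deleting any one of its vertices does not
disconnect it. -/
def IsNonseparable {G : SimpleGraph V} (H : G.Subgraph) : Prop :=
  H.Connected ∧ ∀ v ∈ H.verts, (H.deleteVerts {v}).Preconnected

/-- A block of `G` is a maximal connected subgraph without cut vertices. -/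
def IsBlock {G : SimpleGraph V} (B : G.Subgraph) : Prop :=
  Maximal IsNonseparable B

/-- A (connected) cactus: a connected graph each block of which is an edge or a cycle. -/
def IsCactus (G : SimpleGraph V) : Prop :=
  G.Connected ∧ ∀ B : G.Subgraph, IsBlock B → IsEdgeSubgraph B ∨ IsCycleSubgraph B

/-- `G` belongs to `Cact(n, t)`: it is a connected cactus with `n` vertices and `t` cycles (cycles
being counted as subgraphs). -/
def IsCact [Fintype V] (n t : ℕ) (G : SimpleGraph V) : Prop :=
  IsCactus G ∧ Fintype.card V = n ∧ {C : G.Subgraph | IsCycleSubgraph C}.ncard = t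

end Cactus

section Extremal

/-- The graph `G⁰(n, t)` (for `n ≥ 2 t + 1`): `t` triangles and `n - 2 t - 1` pendent edges, all
sharing the vertex `none`. The other vertices of the `i`-th triangle are `inl (i, false)` and
`inl (i, true)`, and the pendent vertices are `inr p`. -/
def graphG0 (n t : ℕ) : SimpleGraph (Option (Fin t × Bool ⊕ Fin (n - (2 * t + 1)))) :=
  SimpleGraph.fromRel fun x y =>
    match x, y with
    | none, some _ => True
    | some (Sum.inl (i, _)), some (Sum.inl (j, _)) => i = j
    | _, _ => False

/-- The graph `G₅` (for `t ≥ 1` and `n ≥ 2 t + 2`): one 4-cycle, `t - 1` triangles and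
`n - 2 t - 2` pendent edges, all sharing the vertex `none`. The other vertices of the 4-cycle are
`inl 0`, `inl 1`, `inl 2`, in this order along the cycle, the other vertices of the `i`-th triangle
are `inr (inl (i, false))` and `inr (inl (i, true))`, and the pendent vertices are
`inr (inr p)`. -/
def graphG5 (n t : ℕ) :
    SimpleGraph (Option (Fin 3 ⊕ (Fin (t - 1) × Bool ⊕ Fin (n - (2 * t + 2))))) :=
  SimpleGraph.fromRel fun x y =>
    match x, y with
    | none, some (Sum.inl k) => k ≠ 1
    | some (Sum.inl k), some (Sum.inl l) => k = 1 ∧ l ≠ 1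
    | none, some (Sum.inr _) => True
    | some (Sum.inr (Sum.inl (i, _))), some (Sum.inr (Sum.inl (j, _))) => i = j
    | _, _ => False

end Extremal

end DegreeResistance

/-!
The blocks of a cactus are edges and cycles, and every vertex `x` of the graph has a projection to
each block, the vertex of the block closest to `x` (`Retract`, `BlockFamily`). An edge of the graph
is kept by the projection to its own block and collapsed by all others, so resistances add up over
the blocks: `R(u, v)` is the sum of the resistances within the blocks between the projections of `u`
and `v` (`BlockFamily.isResistanceKernel`). Hence `D_R` is a sum of contributions of blocks. Applied
to a block with the vertices `a`, where `1 + x a` vertices project to `a` and the part of the graph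
hanging at `a` has cyclomatic number `y a`, this gives an explicit main term, which depends only on
`n`, `t` and the length of the block, plus the nonnegative excess
`2 * ∑ a b, r (a, b) * (x a + y a) * x b` (`Retract.sum_degree_mul_blockRes`). The excess vanishes
precisely if everything outside the block hangs at a single vertex of it (an *end block*), and
otherwise it is large (`Retract.le_excess_of_not_isEnd`). The numbers of vertices and of cycles are
related to the lengths of the blocks by Foster's theorem (`IsResistanceKernel.sum_adj`), the sum of
the resistances across all edges being `n - 1`.

It remains to compare. Replacing a cycle of length `k ≥ 4` by a triangle and `k - 3` edges lowers
the main term by at least the difference for `k = 4`, with equality only for `k = 4` as `n ≥ 7`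
(`penalty_two_lt`), and an edge or triangle that is no end block costs strictly more than this
(`penalty_two_lt_excess`). So `D_R` is at least the claimed value unless all blocks are edges and
triangles and end blocks, and equality forces exactly one 4-cycle besides edges and triangles, all
of them end blocks. If all blocks are end blocks, they share one vertex (`BlockFamily.isFlower`),
and such a graph is determined by the lengths of its blocks (`IsFlower.nonempty_iso`): it is
`graphG0` in the first case and `graphG5` in the second.

That a cactus has such projections rests on two facts: two cycles with two common vertices lie in
the same block and therefore agree (`IsCactus.cycle_unique`), and consequently deleting the edges
of a cycle separates its vertices from each other (`IsCactus.eq_of_reachable_deleteEdges`).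
-/

namespace DegreeResistance

open Finset
open scoped Classical

/-! ### Resistances within an edge or a cycle -/

section CyclicKernel

/-- How often a vertex of a block is listed when `a + 1` and `a - 1` are taken as the neighbours of
`a` in `ZMod (ℓ + 2)`: twice for `ℓ = 0`, where `a + 1 = a - 1`, and once otherwise. Dividing by it
treats edges and cycles uniformly. -/
noncomputable def stepMult (ℓ : ℕ) : ℝ := if ℓ = 0 then 2 else 1

lemma stepMult_pos (ℓ : ℕ) : 0 < stepMult ℓ := by
  unfold stepMult; split_ifs <;> norm_num

/-- The effective resistance between `0` and `a` in a block with the vertex set `ZMod (ℓ + 2)`,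
which is a single edge for `ℓ = 0` and a cycle of length `ℓ + 2` otherwise. -/
noncomputable def blockRes (ℓ : ℕ) (a : ZMod (ℓ + 2)) : ℝ :=
  stepMult ℓ * ((a.val : ℝ) * ((ℓ : ℝ) + 2 - a.val) / ((ℓ : ℝ) + 2))

@[simp] lemma blockRes_zero (ℓ : ℕ) : blockRes ℓ 0 = 0 := by simp [blockRes]

lemma blockRes_neg (ℓ : ℕ) (a : ZMod (ℓ + 2)) : blockRes ℓ (-a) = blockRes ℓ a := by
  by_cases h : a = 0
  · simp [h]
  · have : NeZero a := ⟨h⟩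
    have hv := ZMod.val_lt a
    simp only [blockRes, ZMod.val_neg_of_ne_zero]
    rw [Nat.cast_sub hv.le]
    push_cast
    ring

lemma blockRes_pos (ℓ : ℕ) {a : ZMod (ℓ + 2)} (h : a ≠ 0) : 0 < blockRes ℓ a := by
  have hv : (a.val : ℝ) < (ℓ : ℝ) + 2 := by exact_mod_cast ZMod.val_lt a
  have h0 : (0 : ℝ) < a.val := by
    exact_mod_cast Nat.pos_of_ne_zero (by rwa [Ne, ZMod.val_eq_zero])
  have := stepMult_pos ℓ
  have h1 : 0 < (ℓ : ℝ) + 2 - a.val := by linarith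
  unfold blockRes
  positivity

lemma blockRes_nonneg (ℓ : ℕ) (a : ZMod (ℓ + 2)) : 0 ≤ blockRes ℓ a := by
  by_cases h : a = 0
  · simp [h]
  · exact (blockRes_pos ℓ h).le

lemma blockRes_add_one (ℓ : ℕ) (a : ZMod (ℓ + 2)) :
    blockRes ℓ (a + 1) =
      stepMult ℓ * (((a.val : ℝ) + 1) * ((ℓ : ℝ) + 2 - (a.val + 1)) / ((ℓ : ℝ) + 2)) := by
  have : Fact (1 < ℓ + 2) := ⟨by omega⟩
  by_cases h : a.val + 1 < ℓ + 2
  · have : (a + 1).val = a.val + 1 := by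
      rw [ZMod.val_add_of_lt] <;> simp [ZMod.val_one, h]
    simp [blockRes, this]
  · have h1 : a.val + 1 = ℓ + 2 := by have := ZMod.val_lt a; omega
    have : (a + 1) = 0 := by
      have : ((a.val + 1 : ℕ) : ZMod (ℓ + 2)) = 0 := by rw [h1]; simp
      simpa using this
    have h2 : (a.val : ℝ) + 1 = (ℓ : ℝ) + 2 := by exact_mod_cast h1
    rw [this, h2]; simp

/-- Away from `0` the second difference of `blockRes` is constant. -/
lemma blockRes_second_difference (ℓ : ℕ) (a : ZMod (ℓ + 2)) :
    blockRes ℓ (a + 1) + blockRes ℓ (a - 1) - 2 * blockRes ℓ a =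
      stepMult ℓ * ((if a = 0 then 2 else 0) - 2 / ((ℓ : ℝ) + 2)) := by
  have : Fact (1 < ℓ + 2) := ⟨by omega⟩
  have hk : (ℓ : ℝ) + 2 ≠ 0 := by positivity
  split_ifs with h
  · subst h
    have h1 := blockRes_add_one ℓ 0
    have h2 : blockRes ℓ (0 - 1) = blockRes ℓ (0 + 1) := by
      rw [zero_sub, zero_add, blockRes_neg]
    rw [h2, h1]
    simp only [blockRes, ZMod.val_zero]
    field_simp
    push_cast
    ring
  · have hpos : 0 < a.val := Nat.pos_of_ne_zero (by rwa [Ne, ZMod.val_eq_zero])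
    have hm : (a - 1).val = a.val - 1 := by
      rw [ZMod.val_sub (by rw [ZMod.val_one]; exact hpos), ZMod.val_one]
    rw [blockRes_add_one]
    simp only [blockRes, hm]
    rw [Nat.cast_sub hpos]
    field_simp
    push_cast
    ring

lemma blockRes_one (ℓ : ℕ) :
    blockRes ℓ 1 = stepMult ℓ * (((ℓ : ℝ) + 1) / ((ℓ : ℝ) + 2)) := by
  have := blockRes_add_one ℓ 0
  rw [zero_add] at this
  rw [this]
  simp
  left
  ring

lemma sum_blockRes (ℓ : ℕ) :
    ∑ a, blockRes ℓ a = stepMult ℓ * (((ℓ : ℝ) + 2) ^ 2 - 1) / 6 := by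
  have hk : (ℓ : ℝ) + 2 ≠ 0 := by positivity
  have key : ∀ N : ℕ, ∀ K : ℝ, ∑ i ∈ range N, (i : ℝ) * (K - i) =
      K * (N * (N - 1) / 2) - (N - 1) * N * (2 * N - 1) / 6 := by
    intro N K
    induction N with
    | zero => simp
    | succ N ih => rw [sum_range_succ, ih]; push_cast; ring
  have h1 : ∑ a, blockRes ℓ a =
      ∑ i : Fin (ℓ + 2), stepMult ℓ * (((i : ℕ) : ℝ) * ((ℓ : ℝ) + 2 - (i : ℕ)) / ((ℓ : ℝ) + 2)) :=
    rfl
  rw [h1, Fin.sum_univ_eq_sum_range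
    (fun i => stepMult ℓ * ((i : ℝ) * ((ℓ : ℝ) + 2 - i) / ((ℓ : ℝ) + 2))), ← mul_sum, ← sum_div,
    key]
  push_cast
  field_simp
  ring

lemma sum_blockRes_sub (ℓ : ℕ) (b : ZMod (ℓ + 2)) :
    ∑ a, blockRes ℓ (a - b) = stepMult ℓ * (((ℓ : ℝ) + 2) ^ 2 - 1) / 6 := by
  rw [← sum_blockRes]
  exact Fintype.sum_equiv (Equiv.subRight b) _ _ (fun _ => rfl)

lemma sum_blockRes_sub' (ℓ : ℕ) (b : ZMod (ℓ + 2)) :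
    ∑ a, blockRes ℓ (b - a) = stepMult ℓ * (((ℓ : ℝ) + 2) ^ 2 - 1) / 6 := by
  rw [← sum_blockRes_sub ℓ b]
  exact sum_congr rfl fun a _ => by rw [← blockRes_neg, neg_sub]

end CyclicKernel

/-! ### Kernels that compute the resistance distance -/

section Kernel

variable {V : Type*} [Fintype V] {G : SimpleGraph V}

/-- A function of two vertices with the properties that characterise the resistance distance:
it is symmetric, vanishes on the diagonal, and `-(r(·, u) - r(·, v)) / 2` is a potential that drives
one unit of current from `u` to `v`. -/
structure IsResistanceKernel (G : SimpleGraph V) (r : V → V → ℝ) : Prop where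
  self : ∀ u, r u u = 0
  symm : ∀ u v, r u v = r v u
  laplacian : ∀ u v w, ∑ x ∈ G.neighborFinset w, ((r w u - r w v) - (r x u - r x v)) =
    -2 * ((if w = u then 1 else 0) - (if w = v then 1 else 0))

lemma lapMatrix_mulVec_eq_sum (φ : V → ℝ) (w : V) :
    (G.lapMatrix ℝ).mulVec φ w = ∑ x ∈ G.neighborFinset w, (φ w - φ x) := by
  rw [SimpleGraph.lapMatrix_mulVec_apply, sum_sub_distrib, sum_const,
    SimpleGraph.card_neighborFinset_eq_degree, nsmul_eq_mul]

theorem IsResistanceKernel.resistance_eq {r : V → V → ℝ} (h : IsResistanceKernel G r) (u v : V) :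
    resistance G u v = r u v := by
  have hφ : IsUnitPotential G u v (fun w => -(r w u - r w v) / 2) := by
    unfold IsUnitPotential
    ext w
    have h1 := lapMatrix_mulVec_eq_sum (G := G) (fun w => -(r w u - r w v) / 2) w
    have h2 := h.laplacian u v w
    have h3 : ∑ x ∈ G.neighborFinset w, (-(r w u - r w v) / 2 - -(r x u - r x v) / 2) =
        -(1 / 2) * ∑ x ∈ G.neighborFinset w, ((r w u - r w v) - (r x u - r x v)) := by
      rw [mul_sum]
      exact sum_congr rfl fun x _ => by ring
    rw [h3, h2] at h1
    convert h1 using 1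
    simp only [Pi.sub_apply, Pi.single_apply]
    ring
  rw [DegreeResistance.resistance_eq hφ, h.self, h.self, h.symm v u]
  ring

/-- Foster's theorem: the resistances across the edges add up to one less than the number of
vertices (here every edge occurs twice). -/
theorem IsResistanceKernel.sum_adj [Nonempty V] {r : V → V → ℝ} (h : IsResistanceKernel G r) :
    ∑ u, ∑ v ∈ G.neighborFinset u, r u v = 2 * ((Fintype.card V : ℝ) - 1) := by
  obtain ⟨o⟩ := ‹Nonempty V›
  -- Take the trace of `L (r(·, w) - r(·, o)) = -2 (δ_w - δ_o)`, that is, evaluate at `w` and sum over `w`.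
  -- The part with `r(·, o)` sums to `0`, because the values of a Laplacian do.
  have h1 : ∀ w, ∑ x ∈ G.neighborFinset w, ((r w w - r w o) - (r x w - r x o)) =
      -2 * (1 - (if w = o then 1 else 0)) := fun w => by
    rw [h.laplacian]; simp
  have h2 : ∀ w, ∑ x ∈ G.neighborFinset w, ((r w w - r w o) - (r x w - r x o)) =
      -(∑ x ∈ G.neighborFinset w, r w x) - ∑ x ∈ G.neighborFinset w, (r w o - r x o) := by
    intro w
    rw [← sum_neg_distrib, ← sum_sub_distrib]
    exact sum_congr rfl fun x _ => by rw [h.self, h.symm x w]; ring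
  have h3 : ∑ w, ∑ x ∈ G.neighborFinset w, (r w o - r x o) = 0 := by
    have : ∀ w, ∑ x ∈ G.neighborFinset w, (r w o - r x o) =
        ∑ x, if G.Adj w x then (r w o - r x o) else 0 := by
      intro w
      rw [← sum_filter]
      exact sum_congr (by ext; simp) fun _ _ => rfl
    have hs : ∑ w, ∑ x, (if G.Adj w x then (r w o - r x o) else 0) =
        -∑ w, ∑ x, (if G.Adj w x then (r w o - r x o) else 0) := by
      conv_lhs => rw [sum_comm]
      rw [← sum_neg_distrib]
      refine sum_congr rfl fun w _ => ?_
      rw [← sum_neg_distrib]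
      refine sum_congr rfl fun x _ => ?_
      simp only [G.adj_comm x w]
      split_ifs <;> ring
    rw [sum_congr rfl fun w _ => this w]
    linarith
  have h4 : ∑ w : V, (-2 * (1 - (if w = o then 1 else 0)) : ℝ) =
      -2 * ((Fintype.card V : ℝ) - 1) := by
    rw [← mul_sum, sum_sub_distrib]
    simp
  rw [← sum_congr rfl fun w _ => h1 w, sum_congr rfl fun w _ => h2 w, sum_sub_distrib, h3,
    sum_neg_distrib] at h4
  linarith

end Kernel

/-! ### Blocks as retracts, and the contribution of a block to `D_R` -/

section Retract

variable {V : Type*}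

/-- A block of `G` that is an edge (`ℓ = 0`) or a cycle of length `ℓ + 2`, given by its vertices
`emb a` in cyclic order together with the projection `proj` which sends a vertex `x` of `G` to the
vertex of the block closest to `x`. The edges of `G` outside the block are collapsed by `proj`. -/
structure Retract (G : SimpleGraph V) (ℓ : ℕ) where
  emb : ZMod (ℓ + 2) → V
  proj : V → ZMod (ℓ + 2)
  proj_emb : ∀ a, proj (emb a) = a
  adj_emb : ∀ a, G.Adj (emb a) (emb (a + 1))
  collapse : ∀ x y, G.Adj x y → proj x ≠ proj y →
    emb (proj x) = x ∧ (proj y = proj x + 1 ∨ proj y = proj x - 1)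

namespace Retract

variable {G : SimpleGraph V} {ℓ : ℕ} (R : Retract G ℓ)

lemma emb_injective : Function.Injective R.emb :=
  Function.LeftInverse.injective R.proj_emb

lemma emb_proj_right {x y : V} (h : G.Adj x y) (hne : R.proj x ≠ R.proj y) :
    R.emb (R.proj y) = y :=
  (R.collapse y x h.symm hne.symm).1

lemma add_one_ne (a : ZMod (ℓ + 2)) : a + 1 ≠ a := by
  have : Fact (1 < ℓ + 2) := ⟨by omega⟩
  simp

lemma sub_one_ne (a : ZMod (ℓ + 2)) : a - 1 ≠ a := by
  have : Fact (1 < ℓ + 2) := ⟨by omega⟩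
  simp

lemma add_one_eq_sub_one_iff (a : ZMod (ℓ + 2)) : a + 1 = a - 1 ↔ ℓ = 0 := by
  have h : a + 1 = a - 1 ↔ ((2 : ℕ) : ZMod (ℓ + 2)) = 0 := by
    rw [← sub_eq_zero]
    push_cast
    ring_nf
  rw [h, ZMod.natCast_eq_zero_iff]
  constructor
  · intro h2
    have := Nat.le_of_dvd (by norm_num) h2
    omega
  · rintro rfl
    norm_num

/-- Summing a function of the projection over the neighbours of `x`: only the neighbours inside the
block count. -/
lemma sum_neighborFinset [Fintype V] (g : ZMod (ℓ + 2) → ℝ) (x : V) (hg : g (R.proj x) = 0) :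
    ∑ y ∈ G.neighborFinset x, g (R.proj y) =
      if R.emb (R.proj x) = x then
        (g (R.proj x + 1) + g (R.proj x - 1)) / stepMult ℓ else 0 := by
  split_ifs with hx
  · set a := R.proj x with ha
    have hsub : (({a + 1, a - 1} : Finset (ZMod (ℓ + 2))).image R.emb) ⊆ G.neighborFinset x := by
      intro y hy
      simp only [mem_image, mem_insert, mem_singleton] at hy
      rw [SimpleGraph.mem_neighborFinset, ← hx]
      obtain ⟨b, rfl | rfl, rfl⟩ := hy
      · exact R.adj_emb a
      · have := R.adj_emb (a - 1)
        rw [sub_add_cancel] at this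
        exact this.symm
    rw [← sum_subset hsub, sum_image (fun _ _ _ _ h => R.emb_injective h)]
    · simp only [R.proj_emb]
      unfold stepMult
      split_ifs with hl
      · have := (add_one_eq_sub_one_iff a).2 hl
        rw [← this]
        simp
      · have : a + 1 ≠ a - 1 := fun h => hl ((add_one_eq_sub_one_iff a).1 h)
        rw [sum_pair this, div_one]
    · intro y hy hy'
      by_cases hya : R.proj y = a
      · rw [hya, hg]
      · exfalso
        rw [SimpleGraph.mem_neighborFinset] at hy
        obtain ⟨-, h2⟩ := R.collapse x y hy (fun h => hya (h.symm))
        refine hy' (mem_image.2 ⟨R.proj y, ?_, R.emb_proj_right hy (fun h => hya h.symm)⟩)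
        simpa using h2
  · refine sum_eq_zero fun y hy => ?_
    rw [SimpleGraph.mem_neighborFinset] at hy
    by_cases hxy : R.proj x = R.proj y
    · rw [← hxy, hg]
    · exact absurd (R.collapse x y hy hxy).1 hx

/-- Across an edge of the block, the resistances within the block give a potential on `G`. -/
lemma laplacian_of_adj [Fintype V] {u v : V} (h : G.Adj u v) (hne : R.proj u ≠ R.proj v) (w : V) :
    ∑ x ∈ G.neighborFinset w,
      ((blockRes ℓ (R.proj w - R.proj u) - blockRes ℓ (R.proj w - R.proj v)) -
        (blockRes ℓ (R.proj x - R.proj u) - blockRes ℓ (R.proj x - R.proj v))) =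
    -2 * ((if w = u then 1 else 0) - (if w = v then 1 else 0)) := by
  have hu := (R.collapse u v h hne).1
  have hv := R.emb_proj_right h hne
  rw [R.sum_neighborFinset (fun a =>
      (blockRes ℓ (R.proj w - R.proj u) - blockRes ℓ (R.proj w - R.proj v)) -
        (blockRes ℓ (a - R.proj u) - blockRes ℓ (a - R.proj v))) w (by ring)]
  have hc := (stepMult_pos ℓ).ne'
  have e1 := blockRes_second_difference ℓ (R.proj w - R.proj u)
  have e2 := blockRes_second_difference ℓ (R.proj w - R.proj v)
  by_cases hw : R.emb (R.proj w) = w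
  · have e3 : R.proj w - R.proj u = 0 ↔ w = u := by
      rw [sub_eq_zero]
      exact ⟨fun e => by rw [← hw, ← hu, e], fun e => by rw [e]⟩
    have e4 : R.proj w - R.proj v = 0 ↔ w = v := by
      rw [sub_eq_zero]
      exact ⟨fun e => by rw [← hw, ← hv, e], fun e => by rw [e]⟩
    simp only [e3] at e1
    simp only [e4] at e2
    rw [if_pos hw, div_eq_iff hc]
    have c1 : ∀ b, R.proj w + 1 - b = R.proj w - b + 1 := fun b => by ring
    have c2 : ∀ b, R.proj w - 1 - b = R.proj w - b - 1 := fun b => by ring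
    rw [c1, c1, c2, c2]
    have d1 : (if w = u then (2 : ℝ) else 0) = 2 * if w = u then 1 else 0 := by
      split_ifs <;> norm_num
    have d2 : (if w = v then (2 : ℝ) else 0) = 2 * if w = v then 1 else 0 := by
      split_ifs <;> norm_num
    rw [d1] at e1
    rw [d2] at e2
    linear_combination e2 - e1
  · have h1 : w ≠ u := fun e => hw (by rw [e, hu])
    have h2 : w ≠ v := fun e => hw (by rw [e, hv])
    simp [hw, h1, h2]

/-- The fibres of the projection are connected: a walk in `G` between two vertices of a fibre can be
cut short whenever it leaves the fibre, which it can only do, and return, at `emb a`. -/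
lemma connected_induce_fiber (hG : G.Connected) (a : ZMod (ℓ + 2)) :
    (G.induce {x | R.proj x = a}).Connected := by
  set H := G.induce {x | R.proj x = a} with hH
  let σ : V → {x | R.proj x = a} := fun x =>
    if h : R.proj x = a then ⟨x, h⟩ else ⟨R.emb a, R.proj_emb a⟩
  have hstep : ∀ x y, G.Adj x y → H.Reachable (σ x) (σ y) := by
    intro x y hxy
    by_cases hx : R.proj x = a <;> by_cases hy : R.proj y = a
    · have : H.Adj (σ x) (σ y) := by simpa [σ, hx, hy, hH] using hxy
      exact this.reachable
    · have := (R.collapse x y hxy (by rw [hx]; exact fun h => hy h.symm)).1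
      rw [hx] at this
      have e : σ x = σ y := by simp [σ, hx, hy, this]
      rw [e]
    · have := (R.collapse y x hxy.symm (by rw [hy]; exact fun h => hx h.symm)).1
      rw [hy] at this
      have e : σ x = σ y := by simp [σ, hx, hy, this]
      rw [e]
    · have e : σ x = σ y := by simp [σ, hx, hy]
      rw [e]
  have hwalk : ∀ x y, G.Walk x y → H.Reachable (σ x) (σ y) := by
    intro x y q
    induction q with
    | nil => exact SimpleGraph.Reachable.refl _
    | cons h _ ih => exact (hstep _ _ h).trans ih
  have hσ : ∀ x : {x | R.proj x = a}, σ x = x := by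
    rintro ⟨x, hx⟩
    have hx' : R.proj x = a := hx
    simp [σ, hx']
  have : Nonempty {x | R.proj x = a} := ⟨⟨R.emb a, R.proj_emb a⟩⟩
  refine ⟨fun x y => ?_⟩
  obtain ⟨q⟩ := hG.preconnected x.1 y.1
  have := hwalk _ _ q
  rwa [hσ, hσ] at this

variable [Fintype V]

/-- The vertices of `G` that project to the vertex `a` of the block. -/
noncomputable def fiber (a : ZMod (ℓ + 2)) : Finset V := univ.filter fun x => R.proj x = a

@[simp] lemma mem_fiber {a : ZMod (ℓ + 2)} {x : V} : x ∈ R.fiber a ↔ R.proj x = a := by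
  simp [fiber]

/-- The number of vertices besides `emb a` that project to `emb a`. -/
noncomputable def extraCard (a : ZMod (ℓ + 2)) : ℝ := ((R.fiber a).card : ℝ) - 1

/-- The cyclomatic number of the part of `G` that hangs at `emb a`, expressed by degree sums: this
part has `extraCard a` edges in a spanning tree, each counted twice in the degree sum, and the block
itself contributes `2 / stepMult ℓ`. -/
noncomputable def extraCycles (a : ZMod (ℓ + 2)) : ℝ :=
  ((∑ x ∈ R.fiber a, (G.degree x : ℝ)) - 2 * R.extraCard a - 2 / stepMult ℓ) / 2

lemma emb_mem_fiber (a : ZMod (ℓ + 2)) : R.emb a ∈ R.fiber a := by simp [R.proj_emb]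

lemma extraCard_nonneg (a : ZMod (ℓ + 2)) : 0 ≤ R.extraCard a := by
  have : 1 ≤ (R.fiber a).card := card_pos.2 ⟨_, R.emb_mem_fiber a⟩
  have : (1 : ℝ) ≤ (R.fiber a).card := by exact_mod_cast this
  unfold extraCard
  linarith

lemma extraCard_eq_natCast (a : ZMod (ℓ + 2)) : ∃ m : ℕ, R.extraCard a = m := by
  have : 1 ≤ (R.fiber a).card := card_pos.2 ⟨_, R.emb_mem_fiber a⟩
  exact ⟨(R.fiber a).card - 1, by rw [extraCard, Nat.cast_sub this]; simp⟩

lemma eq_emb_of_extraCard_eq_zero {a : ZMod (ℓ + 2)} (h : R.extraCard a = 0) {x : V}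
    (hx : R.proj x = a) : x = R.emb a := by
  have : (R.fiber a).card = 1 := by
    have : ((R.fiber a).card : ℝ) = 1 := by unfold extraCard at h; linarith
    exact_mod_cast this
  obtain ⟨z, hz⟩ := card_eq_one.1 this
  have h1 : x ∈ R.fiber a := by simpa using hx
  have h2 := R.emb_mem_fiber a
  rw [hz, mem_singleton] at h1 h2
  rw [h1, h2]

lemma degree_eq (x : V) : (G.degree x : ℝ) =
    ((G.neighborFinset x).filter fun y => R.proj y = R.proj x).card +
      if R.emb (R.proj x) = x then 2 / stepMult ℓ else 0 := by
  have h := R.sum_neighborFinset (fun b => if b = R.proj x then 0 else 1) x (by simp)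
  simp only [add_one_ne, sub_one_ne, if_false] at h
  rw [show (1 : ℝ) + 1 = 2 by norm_num] at h
  rw [← h, ← G.card_neighborFinset_eq_degree,
    ← card_filter_add_card_filter_not (fun y => R.proj y = R.proj x)]
  push_cast
  congr 1
  rw [card_filter]
  push_cast
  exact sum_congr rfl fun y _ => by split_ifs <;> simp_all

lemma sum_degree_fiber (a : ZMod (ℓ + 2)) :
    ∑ x ∈ R.fiber a, (G.degree x : ℝ) =
      ∑ x ∈ R.fiber a, (((G.neighborFinset x).filter fun y => R.proj y = a).card : ℝ) +
        2 / stepMult ℓ := by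
  have h : ∀ x ∈ R.fiber a, (G.degree x : ℝ) =
      (((G.neighborFinset x).filter fun y => R.proj y = a).card : ℝ) +
        if x = R.emb a then 2 / stepMult ℓ else 0 := by
    intro x hx
    rw [mem_fiber] at hx
    rw [R.degree_eq x, hx]
    simp only [eq_comm]
  rw [sum_congr rfl h, sum_add_distrib]
  simp [R.proj_emb]

/-- The part of the graph that hangs at `emb a` is connected, so it has at least as many edges as a
spanning tree. -/
lemma extraCycles_nonneg (hG : G.Connected) (a : ZMod (ℓ + 2)) : 0 ≤ R.extraCycles a := by
  set H := G.induce {x | R.proj x = a} with hH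
  have hconn : H.Connected := R.connected_induce_fiber hG a
  have h1 := hconn.card_vert_le_card_edgeSet_add_one
  have h2 := H.sum_degrees_eq_twice_card_edges
  have h3 : Nat.card {x | R.proj x = a} = (R.fiber a).card := by
    rw [Nat.card_eq_fintype_card]
    exact Fintype.card_of_subtype _ fun x => by simp
  have h4 : Nat.card H.edgeSet = H.edgeFinset.card := by
    rw [Nat.card_eq_fintype_card, SimpleGraph.edgeFinset_card]
  have h5 : ∑ v, H.degree v =
      ∑ x ∈ R.fiber a, ((G.neighborFinset x).filter fun y => R.proj y = a).card := by
    have hd : ∀ v : {x | R.proj x = a},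
        H.degree v = ((G.neighborFinset v).filter fun y => R.proj y = a).card := by
      intro v
      rw [← H.card_neighborFinset_eq_degree]
      refine card_bij (fun y _ => y.1) ?_ (fun _ _ _ _ h => Subtype.ext h) ?_
      · rintro ⟨y, hy⟩ h
        have h' : G.Adj v y := by simpa [hH] using h
        exact mem_filter.2 ⟨by simpa using h', hy⟩
      · intro y hy
        simp only [mem_filter, SimpleGraph.mem_neighborFinset] at hy
        exact ⟨⟨y, hy.2⟩, by simpa [hH] using hy.1, rfl⟩
    rw [sum_congr rfl fun v _ => hd v]
    exact (sum_subtype (R.fiber a) (fun x => by simp)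
      (fun x => ((G.neighborFinset x).filter fun y => R.proj y = a).card)).symm
  have h6 : (2 * ((R.fiber a).card : ℝ)) ≤
      ∑ x ∈ R.fiber a, (((G.neighborFinset x).filter fun y => R.proj y = a).card : ℝ) + 2 := by
    have : 2 * (R.fiber a).card ≤
        ∑ x ∈ R.fiber a, ((G.neighborFinset x).filter fun y => R.proj y = a).card + 2 := by
      rw [← h5, h2, ← h4, ← h3]; omega
    exact_mod_cast this
  rw [extraCycles, R.sum_degree_fiber, extraCard]
  linarith

lemma extraCycles_eq_zero {a : ZMod (ℓ + 2)} (h : R.extraCard a = 0) : R.extraCycles a = 0 := by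
  have h1 : R.fiber a = {R.emb a} := by
    ext x
    rw [mem_fiber, mem_singleton]
    exact ⟨fun hx => R.eq_emb_of_extraCard_eq_zero h hx, fun hx => by rw [hx, R.proj_emb]⟩
  have h2 : ((G.neighborFinset (R.emb a)).filter fun y => R.proj y = a) = ∅ := by
    refine filter_eq_empty_iff.2 fun {y} hy hya => ?_
    rw [R.eq_emb_of_extraCard_eq_zero h hya] at hy
    simp at hy
  rw [extraCycles, R.sum_degree_fiber, h, h1, sum_singleton, h2]
  simp

lemma sum_extraCard : ∑ a, R.extraCard a = (Fintype.card V : ℝ) - ((ℓ : ℝ) + 2) := by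
  have h : ∑ a, (R.fiber a).card = Fintype.card V := by
    rw [← card_univ, card_eq_sum_card_fiberwise (f := R.proj) (t := univ) (by simp)]
    rfl
  have h' : ∑ a, ((R.fiber a).card : ℝ) = Fintype.card V := by exact_mod_cast h
  simp only [extraCard, sum_sub_distrib, h']
  simp [ZMod.card]

lemma sum_extraCycles : ∑ a, R.extraCycles a =
    (∑ x, (G.degree x : ℝ)) / 2 - (Fintype.card V : ℝ) + ((ℓ : ℝ) + 2) -
      ((ℓ : ℝ) + 2) / stepMult ℓ := by
  have h : ∑ a, ∑ x ∈ R.fiber a, (G.degree x : ℝ) = ∑ x, (G.degree x : ℝ) :=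
    sum_fiberwise univ R.proj _
  simp only [extraCycles]
  rw [← sum_div, sum_sub_distrib, sum_sub_distrib, h, ← mul_sum, R.sum_extraCard]
  simp [ZMod.card]
  ring

/-- The nonnegative quantity by which the contribution of a block to `D_R` exceeds the contribution
of a block of the same length in which everything else hangs at one vertex. -/
noncomputable def excess : ℝ :=
  2 * ∑ a, ∑ b, blockRes ℓ (a - b) * ((R.extraCard a + R.extraCycles a) * R.extraCard b)

lemma excess_nonneg (hG : G.Connected) : 0 ≤ R.excess := by
  refine mul_nonneg two_pos.le (sum_nonneg fun a _ => sum_nonneg fun b _ => ?_)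
  exact mul_nonneg (blockRes_nonneg _ _) (mul_nonneg
    (add_nonneg (R.extraCard_nonneg a) (R.extraCycles_nonneg hG a)) (R.extraCard_nonneg b))

/-- The contribution of a block to `D_R`. -/
lemma sum_degree_mul_blockRes :
    ∑ u, ∑ v, (G.degree u : ℝ) * blockRes ℓ (R.proj u - R.proj v) =
      stepMult ℓ * (((ℓ : ℝ) + 2) ^ 2 - 1) / 6 *
        ((2 + 2 / stepMult ℓ) * (Fintype.card V : ℝ) - 2 / stepMult ℓ * ((ℓ : ℝ) + 2) +
          ((∑ x, (G.degree x : ℝ)) - 2 * (Fintype.card V : ℝ))) + R.excess := by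
  set ρ := stepMult ℓ * (((ℓ : ℝ) + 2) ^ 2 - 1) / 6 with hρ
  set δ := 2 / stepMult ℓ with hδ
  have h1 : ∑ u, ∑ v, (G.degree u : ℝ) * blockRes ℓ (R.proj u - R.proj v) =
      ∑ a, ∑ b, blockRes ℓ (a - b) *
        ((2 * R.extraCard a + δ + 2 * R.extraCycles a) * (1 + R.extraCard b)) := by
    have e1 : ∀ u, ∑ v, (G.degree u : ℝ) * blockRes ℓ (R.proj u - R.proj v) =
        ∑ b, (G.degree u : ℝ) * (blockRes ℓ (R.proj u - b) * (1 + R.extraCard b)) := by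
      intro u
      rw [← sum_fiberwise univ R.proj]
      refine sum_congr rfl fun b _ => ?_
      have : ∀ v ∈ univ.filter (fun x => R.proj x = b),
          (G.degree u : ℝ) * blockRes ℓ (R.proj u - R.proj v) =
          (G.degree u : ℝ) * blockRes ℓ (R.proj u - b) := by
        intro v hv
        rw [(mem_filter.1 hv).2]
      rw [sum_congr rfl this, sum_const, nsmul_eq_mul, extraCard, fiber]
      ring
    rw [sum_congr rfl fun u _ => e1 u, ← sum_fiberwise univ R.proj]
    refine sum_congr rfl fun a _ => ?_
    rw [sum_comm]
    refine sum_congr rfl fun b _ => ?_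
    have : ∀ u ∈ univ.filter (fun x => R.proj x = a),
        (G.degree u : ℝ) * (blockRes ℓ (R.proj u - b) * (1 + R.extraCard b)) =
        (G.degree u : ℝ) * (blockRes ℓ (a - b) * (1 + R.extraCard b)) := by
      intro u hu
      rw [(mem_filter.1 hu).2]
    rw [sum_congr rfl this, ← sum_mul]
    have h2 : ∑ x with R.proj x = a, (G.degree x : ℝ) =
        2 * R.extraCard a + δ + 2 * R.extraCycles a := by
      rw [extraCycles, fiber]
      ring
    rw [h2]
    ring
  -- The first two summands contain only row sums of `blockRes`, which do not depend on the row; the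
  -- third one is the excess.
  have h2 : ∀ a b, blockRes ℓ (a - b) *
        ((2 * R.extraCard a + δ + 2 * R.extraCycles a) * (1 + R.extraCard b)) =
      (2 * R.extraCard a + δ + 2 * R.extraCycles a) * blockRes ℓ (a - b) +
      δ * (R.extraCard b * blockRes ℓ (a - b)) +
      2 * (blockRes ℓ (a - b) * ((R.extraCard a + R.extraCycles a) * R.extraCard b)) := by
    intro a b
    ring
  have h3 : ∑ a, ∑ b, (2 * R.extraCard a + δ + 2 * R.extraCycles a) * blockRes ℓ (a - b) =
      (2 * ((Fintype.card V : ℝ) - ((ℓ : ℝ) + 2)) + δ * ((ℓ : ℝ) + 2) +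
        2 * ((∑ x, (G.degree x : ℝ)) / 2 - (Fintype.card V : ℝ) + ((ℓ : ℝ) + 2) -
          ((ℓ : ℝ) + 2) / stepMult ℓ)) * ρ := by
    simp only [← mul_sum, sum_blockRes_sub', ← sum_mul, sum_add_distrib, R.sum_extraCard,
      R.sum_extraCycles]
    simp [ZMod.card]
    ring
  have h4 : ∑ a, ∑ b, δ * (R.extraCard b * blockRes ℓ (a - b)) =
      δ * (((Fintype.card V : ℝ) - ((ℓ : ℝ) + 2)) * ρ) := by
    rw [sum_comm]
    simp only [← mul_sum, sum_blockRes_sub, ← sum_mul, R.sum_extraCard]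
    rw [hρ]
  rw [h1]
  simp only [h2, sum_add_distrib]
  rw [h3, h4, excess]
  simp only [← mul_sum]
  have hc := (stepMult_pos ℓ).ne'
  rw [hδ]
  field_simp
  ring

/-- Summing over the edges of `G` inside a block (each of them occurs twice). -/
lemma sum_sum_neighborFinset (g : ZMod (ℓ + 2) → ℝ) (h0 : g 0 = 0) (hneg : ∀ a, g (-a) = g a) :
    ∑ u, ∑ v ∈ G.neighborFinset u, g (R.proj u - R.proj v) =
      2 * ((ℓ : ℝ) + 2) * g 1 / stepMult ℓ := by
  have h1 : ∀ u, ∑ v ∈ G.neighborFinset u, g (R.proj u - R.proj v) =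
      if R.emb (R.proj u) = u then 2 * g 1 / stepMult ℓ else 0 := by
    intro u
    rw [R.sum_neighborFinset (fun b => g (R.proj u - b)) u (by simpa using h0)]
    have e1 : R.proj u - (R.proj u + 1) = -1 := by ring
    have e2 : R.proj u - (R.proj u - 1) = 1 := by ring
    rw [e1, e2, hneg, two_mul]
  have h2 : univ.filter (fun u => R.emb (R.proj u) = u) = univ.image R.emb := by
    ext u
    simp only [mem_filter, mem_univ, true_and, mem_image]
    exact ⟨fun h => ⟨_, h⟩, by rintro ⟨a, rfl⟩; rw [R.proj_emb]⟩
  rw [sum_congr rfl fun u _ => h1 u, ← sum_filter, h2, sum_const,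
    card_image_of_injective _ R.emb_injective, card_univ, ZMod.card, nsmul_eq_mul]
  push_cast
  ring

end Retract

end Retract

/-! ### Decomposition of a graph into blocks -/

section BlockFamily

variable {V I : Type*} {G : SimpleGraph V} {ℓ : I → ℕ}

/-- A decomposition of the edges of `G` into blocks, each an edge or a cycle: every edge of `G` is
kept by exactly one of the projections. -/
structure BlockFamily (G : SimpleGraph V) (ℓ : I → ℕ) where
  block : ∀ i, Retract G (ℓ i)
  existsUnique_ne : ∀ u v, G.Adj u v → ∃! i, (block i).proj u ≠ (block i).proj v

/-- The contribution to `D_R` of a block of length `ℓ + 2`, in a graph with `n` vertices and `t`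
cycles, if all other vertices hang at one vertex of the block. -/
noncomputable def blockValue (n t : ℝ) (ℓ : ℕ) : ℝ :=
  stepMult ℓ * (((ℓ : ℝ) + 2) ^ 2 - 1) / 6 *
    ((2 + 2 / stepMult ℓ) * n - 2 / stepMult ℓ * ((ℓ : ℝ) + 2) + 2 * (t - 1))

namespace BlockFamily

variable (F : BlockFamily G ℓ)

/-- Every other block projects a given block to a single vertex. -/
lemma proj_emb_of_ne {i j : I} (h : i ≠ j) (a b : ZMod (ℓ i + 2)) :
    (F.block j).proj ((F.block i).emb a) = (F.block j).proj ((F.block i).emb b) := by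
  have hstep : ∀ a, (F.block j).proj ((F.block i).emb (a + 1)) =
      (F.block j).proj ((F.block i).emb a) := by
    intro a
    by_contra hne
    have hadj := (F.block i).adj_emb a
    refine h ((F.existsUnique_ne _ _ hadj).unique ?_ (Ne.symm hne))
    rw [(F.block i).proj_emb, (F.block i).proj_emb]
    exact (Retract.add_one_ne a).symm
  have h0 : ∀ m : ℕ, (F.block j).proj ((F.block i).emb m) =
      (F.block j).proj ((F.block i).emb 0) := by
    intro m
    induction m with
    | zero => simp
    | succ m ih => rw [Nat.cast_succ, hstep, ih]
  have h1 := h0 a.val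
  have h2 := h0 b.val
  rw [ZMod.natCast_zmod_val] at h1 h2
  rw [h1, h2]

variable [Fintype V] [Fintype I]

/-- The resistances add up over the blocks. -/
theorem isResistanceKernel (hG : G.Connected) : IsResistanceKernel G
    (fun u v => ∑ i, blockRes (ℓ i) ((F.block i).proj u - (F.block i).proj v)) where
  self u := by simp
  symm u v := sum_congr rfl fun i _ => by rw [← blockRes_neg, neg_sub]
  laplacian := by
    set r : V → V → ℝ :=
      fun u v => ∑ i, blockRes (ℓ i) ((F.block i).proj u - (F.block i).proj v) with hr
    have hadj : ∀ u v, G.Adj u v → ∀ w,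
        ∑ x ∈ G.neighborFinset w, ((r w u - r w v) - (r x u - r x v)) =
          -2 * ((if w = u then 1 else 0) - (if w = v then 1 else 0)) := by
      intro u v huv w
      obtain ⟨i, hi, huniq⟩ := F.existsUnique_ne u v huv
      rw [← (F.block i).laplacian_of_adj huv hi w]
      -- Only the block that contains the edge `u v` contributes to the potential.
      have hdiff : ∀ x, r x u - r x v =
          blockRes (ℓ i) ((F.block i).proj x - (F.block i).proj u) -
            blockRes (ℓ i) ((F.block i).proj x - (F.block i).proj v) := by
        intro x
        rw [hr, ← sum_sub_distrib]
        refine sum_eq_single i (fun j _ hj => ?_) (by simp)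
        have : (F.block j).proj u = (F.block j).proj v := by
          by_contra h
          exact hj (huniq j h)
        rw [this, sub_self]
      exact sum_congr rfl fun x _ => by rw [hdiff, hdiff]
    intro u v w
    obtain ⟨q⟩ := hG.preconnected u v
    induction q with
    | nil => simp
    | cons h _ ih =>
      have e := hadj _ _ h w
      have e2 := congrArg₂ (· + ·) e ih
      simp only [← sum_add_distrib] at e2
      convert e2 using 1
      · exact sum_congr rfl fun x _ => by ring
      · ring

lemma resistance_eq (hG : G.Connected) (u v : V) : resistance G u v =
    ∑ i, blockRes (ℓ i) ((F.block i).proj u - (F.block i).proj v) :=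
  (F.isResistanceKernel hG).resistance_eq u v

include F in
/-- A vertex is determined by its projections, for otherwise the potential that drives a current from
`u` to `v` would vanish. -/
lemma eq_of_proj_eq (hG : G.Connected) {u v : V}
    (h : ∀ i, (F.block i).proj u = (F.block i).proj v) : u = v := by
  by_contra hne
  have := (F.isResistanceKernel hG).laplacian u v u
  simp [h, hne] at this

include F in
lemma sum_length (hG : G.Connected) : ∑ i, ((ℓ i : ℝ) + 1) = (Fintype.card V : ℝ) - 1 := by
  have : Nonempty V := hG.nonempty
  have h := (F.isResistanceKernel hG).sum_adj
  have h1 : ∑ u, ∑ v ∈ G.neighborFinset u,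
      ∑ i, blockRes (ℓ i) ((F.block i).proj u - (F.block i).proj v) =
      ∑ i, ∑ u, ∑ v ∈ G.neighborFinset u,
        blockRes (ℓ i) ((F.block i).proj u - (F.block i).proj v) := by
    rw [sum_comm]
    exact sum_congr rfl fun u _ => sum_comm
  have h2 : ∀ i, ∑ u, ∑ v ∈ G.neighborFinset u,
        blockRes (ℓ i) ((F.block i).proj u - (F.block i).proj v) = 2 * ((ℓ i : ℝ) + 1) := by
    intro i
    rw [(F.block i).sum_sum_neighborFinset _ (blockRes_zero _) (blockRes_neg _), blockRes_one]
    have := (stepMult_pos (ℓ i)).ne'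
    have : (ℓ i : ℝ) + 2 ≠ 0 := by positivity
    field_simp
  rw [h1, sum_congr rfl fun i _ => h2 i, ← mul_sum] at h
  linarith

include F in
/-- The cyclomatic number of `G` is the number of its cycles. -/
lemma sum_degree (hG : G.Connected) : ∑ u, (G.degree u : ℝ) =
    2 * ((Fintype.card V : ℝ) - 1) + 2 * ((univ.filter fun i => ℓ i ≠ 0).card : ℝ) := by
  have h1 : ∀ u, (G.degree u : ℝ) = ∑ v ∈ G.neighborFinset u,
      ∑ i, if (F.block i).proj u - (F.block i).proj v = 0 then (0 : ℝ) else 1 := by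
    intro u
    rw [← G.card_neighborFinset_eq_degree, card_eq_sum_ones]
    push_cast
    refine sum_congr rfl fun v hv => ?_
    obtain ⟨i, hi, huniq⟩ := F.existsUnique_ne u v (by simpa using hv)
    rw [sum_eq_single i]
    · rw [if_neg (sub_ne_zero.2 hi)]
    · intro j _ hj
      rw [if_pos]
      rw [sub_eq_zero]
      by_contra h
      exact hj (huniq j h)
    · simp
  have h2 : ∀ i, ∑ u, ∑ v ∈ G.neighborFinset u,
      (if (F.block i).proj u - (F.block i).proj v = 0 then (0 : ℝ) else 1) =
        2 * ((ℓ i : ℝ) + 1) + 2 * (if ℓ i ≠ 0 then 1 else 0) := by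
    intro i
    rw [(F.block i).sum_sum_neighborFinset (fun a => if a = 0 then (0 : ℝ) else 1) (by simp)
      (by simp)]
    have : Fact (1 < ℓ i + 2) := ⟨by omega⟩
    simp only [one_ne_zero, if_false, stepMult]
    split_ifs <;> simp_all
    ring
  rw [sum_congr rfl fun u _ => h1 u, sum_congr rfl fun u _ => sum_comm, sum_comm,
    sum_congr rfl fun i _ => h2 i, sum_add_distrib, ← mul_sum, ← mul_sum, F.sum_length hG, sum_boole]

theorem degreeResistance_eq (hG : G.Connected) {t : ℕ}
    (ht : (univ.filter fun i => ℓ i ≠ 0).card = t) :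
    degreeResistance G =
      ∑ i, (blockValue (Fintype.card V) t (ℓ i) + (F.block i).excess) := by
  have hsymm : ∀ u v, resistance G u v = resistance G v u := fun u v => by
    rw [F.resistance_eq hG, F.resistance_eq hG]
    exact (F.isResistanceKernel hG).symm u v
  have h1 : degreeResistance G = ∑ u, ∑ v, (G.degree u : ℝ) * resistance G u v := by
    have e : ∑ u, ∑ v, (G.degree v : ℝ) * resistance G u v =
        ∑ u, ∑ v, (G.degree u : ℝ) * resistance G u v := by
      rw [sum_comm]
      exact sum_congr rfl fun u _ => sum_congr rfl fun v _ => by rw [hsymm]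
    unfold degreeResistance
    simp only [add_mul, sum_add_distrib]
    rw [e]
    ring
  rw [h1]
  simp only [F.resistance_eq hG, mul_sum]
  rw [sum_congr rfl fun u _ => sum_comm, sum_comm]
  refine sum_congr rfl fun i _ => ?_
  rw [(F.block i).sum_degree_mul_blockRes, F.sum_degree hG, ht, blockValue]
  ring

end BlockFamily

end BlockFamily

/-! ### End blocks -/

section Excess

lemma blockRes_one_le (ℓ : ℕ) {a : ZMod (ℓ + 2)} (h : a ≠ 0) : blockRes ℓ 1 ≤ blockRes ℓ a := by
  have hv : a.val + 1 ≤ ℓ + 2 := ZMod.val_lt a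
  have h0 : 1 ≤ a.val := Nat.pos_of_ne_zero (by rwa [Ne, ZMod.val_eq_zero])
  have hv' : (a.val : ℝ) + 1 ≤ (ℓ : ℝ) + 2 := by exact_mod_cast hv
  have h0' : (1 : ℝ) ≤ a.val := by exact_mod_cast h0
  rw [blockRes_one, blockRes]
  have := stepMult_pos ℓ
  gcongr
  nlinarith

variable {V : Type*} [Fintype V] {G : SimpleGraph V} {ℓ : ℕ} (R : Retract G ℓ)

/-- All vertices outside the block hang at the same vertex `emb a` of the block. -/
def Retract.IsEnd : Prop := ∃ a, ∀ b, b ≠ a → R.extraCard b = 0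

lemma Retract.IsEnd.excess_eq_zero {R : Retract G ℓ} (h : R.IsEnd) : R.excess = 0 := by
  obtain ⟨a, ha⟩ := h
  rw [excess, sum_eq_zero, mul_zero]
  intro b _
  refine sum_eq_zero fun c _ => ?_
  by_cases hb : b = a
  · by_cases hc : c = a
    · rw [hb, hc, sub_self, blockRes_zero, zero_mul]
    · rw [ha c hc, mul_zero, mul_zero]
  · rw [ha b hb, R.extraCycles_eq_zero (ha b hb)]
    simp

/-- If the other vertices hang at two or more vertices of the block, at least two distinct
vertices `a ≠ b` carry some; already the products of the weight at `a` with the others are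
large. -/
lemma Retract.le_excess_of_not_isEnd (hG : G.Connected) (h : ¬ R.IsEnd) :
    1 ≤ (Fintype.card V : ℝ) - (ℓ + 3) ∧
      4 * blockRes ℓ 1 * ((Fintype.card V : ℝ) - (ℓ + 3)) ≤ R.excess := by
  have hone : ∀ b, R.extraCard b ≠ 0 → 1 ≤ R.extraCard b := by
    intro b hb
    obtain ⟨m, hm⟩ := R.extraCard_eq_natCast b
    rw [hm] at hb ⊢
    exact_mod_cast Nat.one_le_iff_ne_zero.2 (by exact_mod_cast hb)
  unfold IsEnd at h
  push Not at h
  obtain ⟨a, -, ha⟩ := h 0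
  obtain ⟨b, hba, hb⟩ := h a
  have ha1 := hone a ha
  have hb1 := hone b hb
  have hS := R.sum_extraCard
  set S := ∑ a, R.extraCard a with hSdef
  have hrest : ∑ c ∈ univ.erase a, R.extraCard c = S - R.extraCard a := by
    rw [hSdef, ← add_sum_erase univ _ (mem_univ a)]; ring
  have hrest1 : 1 ≤ S - R.extraCard a := by
    rw [← hrest]
    exact hb1.trans (single_le_sum (f := R.extraCard) (fun c _ => R.extraCard_nonneg c)
      (mem_erase.2 ⟨hba, mem_univ b⟩))
  have hr1 : 0 ≤ blockRes ℓ 1 := blockRes_nonneg ℓ 1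
  have hterm : ∀ c d, 0 ≤
      blockRes ℓ (c - d) * ((R.extraCard c + R.extraCycles c) * R.extraCard d) := fun c d =>
    mul_nonneg (blockRes_nonneg _ _) (mul_nonneg
      (add_nonneg (R.extraCard_nonneg c) (R.extraCycles_nonneg hG c)) (R.extraCard_nonneg d))
  have hle : ∀ c d, c ≠ d → blockRes ℓ 1 * (R.extraCard c * R.extraCard d) ≤
      blockRes ℓ (c - d) * ((R.extraCard c + R.extraCycles c) * R.extraCard d) := by
    intro c d hcd
    have h1 := R.extraCard_nonneg c
    have h2 := R.extraCard_nonneg d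
    have h3 := R.extraCycles_nonneg hG c
    have h4 := blockRes_one_le ℓ (sub_ne_zero.2 hcd)
    exact mul_le_mul h4 (by nlinarith) (mul_nonneg h1 h2) (hr1.trans h4)
  have hrow : blockRes ℓ 1 * (R.extraCard a * (S - R.extraCard a)) ≤
      ∑ d, blockRes ℓ (a - d) * ((R.extraCard a + R.extraCycles a) * R.extraCard d) := by
    rw [← hrest, mul_sum, mul_sum]
    refine (sum_le_sum fun d hd => hle a d (ne_of_mem_erase hd).symm).trans ?_
    exact sum_le_sum_of_subset_of_nonneg (subset_univ _) fun d _ _ => hterm a d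
  have hcol : blockRes ℓ 1 * (R.extraCard a * (S - R.extraCard a)) ≤
      ∑ c ∈ univ.erase a,
        ∑ d, blockRes ℓ (c - d) * ((R.extraCard c + R.extraCycles c) * R.extraCard d) := by
    rw [← hrest, mul_sum, mul_sum]
    refine sum_le_sum fun c hc => ?_
    rw [mul_comm (R.extraCard a)]
    exact (hle c a (ne_of_mem_erase hc)).trans
      (single_le_sum (f := fun d =>
        blockRes ℓ (c - d) * ((R.extraCard c + R.extraCycles c) * R.extraCard d))
        (fun d _ => hterm c d) (mem_univ a))
  have hprod : S - 1 ≤ R.extraCard a * (S - R.extraCard a) := by nlinarith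
  have hprod' := mul_le_mul_of_nonneg_left hprod hr1
  refine ⟨by linarith, ?_⟩
  rw [excess, ← add_sum_erase univ _ (mem_univ a)]
  have : (Fintype.card V : ℝ) - (ℓ + 3) = S - 1 := by linarith
  rw [this]
  linarith

lemma Retract.isEnd_of_excess_eq_zero (hG : G.Connected) (h : R.excess = 0) : R.IsEnd := by
  by_contra hend
  obtain ⟨h1, h2⟩ := R.le_excess_of_not_isEnd hG hend
  have : Fact (1 < ℓ + 2) := ⟨by omega⟩
  have := blockRes_pos ℓ (one_ne_zero (α := ZMod (ℓ + 2)))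
  rw [h] at h2
  nlinarith

end Excess

/-! ### Edges and cycles sharing one vertex -/

section Flower

variable {V W I J : Type*} {G : SimpleGraph V} {H : SimpleGraph W} {ℓ : I → ℕ}

/-- `G` consists of blocks with the vertex sets `ZMod (ℓ i + 2)`, an edge for `ℓ i = 0` and a cycle
otherwise, whose vertices `0` are identified. A vertex `u` is given by the family `ρ u` of its
projections to the blocks, of which at most one is different from `0`. -/
def IsFlower (G : SimpleGraph V) (ℓ : I → ℕ) : Prop :=
  ∃ ρ : V → ∀ i, ZMod (ℓ i + 2), Function.Injective ρ ∧
    (∀ x, (∃ u, ρ u = x) ↔ ∃ i, ∀ j, j ≠ i → x j = 0) ∧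
    ∀ u v, G.Adj u v ↔ ∃ i, (ρ v i = ρ u i + 1 ∨ ρ u i = ρ v i + 1) ∧
      ∀ j, j ≠ i → ρ u j = 0 ∧ ρ v j = 0

/-- A flower is determined by the lengths of its blocks. -/
theorem IsFlower.nonempty_iso (hG : IsFlower G ℓ) (hH : IsFlower H ℓ) : Nonempty (G ≃g H) := by
  obtain ⟨ρ, hinj, hran, hadj⟩ := hG
  obtain ⟨σ, hinj', hran', hadj'⟩ := hH
  have h1 : ∀ u, ∃ w, σ w = ρ u := fun u => (hran' _).2 ((hran _).1 ⟨u, rfl⟩)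
  have h2 : ∀ w, ∃ u, ρ u = σ w := fun w => (hran _).2 ((hran' _).1 ⟨w, rfl⟩)
  choose f hf using h1
  choose g hg using h2
  exact ⟨⟨⟨f, g, fun u => hinj (by rw [hg, hf]), fun w => hinj' (by rw [hf, hg])⟩,
    fun {u v} => by simp [hadj, hadj', hf]⟩⟩

theorem IsFlower.reindex (hG : IsFlower G ℓ) (e : J ≃ I) : IsFlower G (ℓ ∘ e) := by
  obtain ⟨ρ, hinj, hran, hadj⟩ := hG
  refine ⟨fun u j => ρ u (e j), ?_, ?_, ?_⟩
  · intro u v huv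
    refine hinj (funext fun i => ?_)
    obtain ⟨j, rfl⟩ := e.surjective i
    exact congrFun huv j
  · intro x
    have hx := hran ((Equiv.piCongrLeft (fun i => ZMod (ℓ i + 2)) e) x)
    constructor
    · rintro ⟨u, rfl⟩
      obtain ⟨i, hi⟩ := (hran _).1 ⟨u, rfl⟩
      exact ⟨e.symm i, fun j hj => hi _ fun h => hj (by simp [← h])⟩
    · rintro ⟨j, hj⟩
      obtain ⟨u, hu⟩ := hx.2 ⟨e j, fun i hi => by
        obtain ⟨j', rfl⟩ := e.surjective i
        rw [Equiv.piCongrLeft_apply_apply]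
        exact hj j' fun h => hi (by rw [h])⟩
      exact ⟨u, funext fun j' =>
        (congrFun hu (e j')).trans 
          (Equiv.piCongrLeft_apply_apply (fun i => ZMod (ℓ i + 2)) e x j')⟩
  · intro u v
    rw [hadj]
    constructor
    · rintro ⟨i, h1, h2⟩
      obtain ⟨j, rfl⟩ := e.surjective i
      exact ⟨j, h1, fun j' hj' => h2 _ fun h => hj' (e.injective h)⟩
    · rintro ⟨j, h1, h2⟩
      refine ⟨e j, h1, fun i hi => ?_⟩
      obtain ⟨j', rfl⟩ := e.surjective i
      exact h2 j' fun h => hi (by rw [h])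

theorem IsFlower.of_iso (hG : IsFlower G ℓ) (e : H ≃g G) : IsFlower H ℓ := by
  obtain ⟨ρ, hinj, hran, hadj⟩ := hG
  refine ⟨fun u => ρ (e u), hinj.comp e.injective, fun x => ?_, fun u v => ?_⟩
  · rw [← hran, e.surjective.exists]
  · rw [← hadj]; exact e.map_adj_iff.symm

/-- In a flower, every block is an end block. -/
theorem IsFlower.exists_blockFamily [Fintype V] (hG : IsFlower G ℓ) :
    ∃ F : BlockFamily G ℓ, ∀ i, (F.block i).IsEnd := by
  obtain ⟨ρ, hinj, hran, hadj⟩ := hG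
  have h1 : ∀ i a, ∃ u, ρ u = Function.update (0 : ∀ i, ZMod (ℓ i + 2)) i a := fun i a =>
    (hran _).2 ⟨i, fun j hj => by rw [Function.update_of_ne hj]; rfl⟩
  choose emb hemb using h1
  have hsupp : ∀ i u, (∀ j, j ≠ i → ρ u j = 0) → emb i (ρ u i) = u := by
    intro i u hu
    refine hinj (funext fun j => ?_)
    rw [hemb]
    by_cases hj : j = i
    · subst hj; simp
    · rw [Function.update_of_ne hj, hu j hj]; rfl
  let F : BlockFamily G ℓ :=
    { block := fun i =>
        { emb := emb i
          proj := fun u => ρ u i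
          proj_emb := fun a => by rw [hemb]; simp
          adj_emb := fun a => (hadj _ _).2 ⟨i, by simp [hemb], fun j hj => by
            simp [hemb, Function.update_of_ne hj]⟩
          collapse := fun x y hxy hne => by
            obtain ⟨j, h2, h3⟩ := (hadj _ _).1 hxy
            by_cases hj : j = i
            · subst hj
              refine ⟨hsupp _ _ fun j' hj' => (h3 j' hj').1, h2.imp id fun h => ?_⟩
              rw [h]; ring
            · exact absurd ((h3 i (Ne.symm hj)).1.trans (h3 i (Ne.symm hj)).2.symm) hne }
      existsUnique_ne := fun u v huv => by
        obtain ⟨i, h2, h3⟩ := (hadj _ _).1 huv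
        refine ⟨i, ?_, fun j hj => ?_⟩
        · rcases h2 with h | h
          · show ρ u i ≠ ρ v i
            rw [h]; exact (Retract.add_one_ne _).symm
          · show ρ u i ≠ ρ v i
            rw [h]; exact Retract.add_one_ne _
        · by_contra hne
          exact hj ((h3 j hne).1.trans (h3 j hne).2.symm) }
  refine ⟨F, fun i => ⟨0, fun b hb => ?_⟩⟩
  have : (F.block i).fiber b = {emb i b} := by
    ext u
    rw [Retract.mem_fiber, mem_singleton]
    constructor
    · intro hu
      have hu' : ρ u i = b := hu
      obtain ⟨k, hk⟩ := (hran _).1 ⟨u, rfl⟩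
      have : k = i := by
        by_contra hne
        exact hb (hu' ▸ hk i (Ne.symm hne))
      subst this
      rw [← hu']
      exact (hsupp _ u hk).symm
    · rintro rfl
      exact (F.block i).proj_emb b
  rw [Retract.extraCard, this]
  simp

/-- If all blocks are end blocks, the vertices at which everything else hangs agree: such a vertex
of the block `i`, were it different from the one of the block `j`, could only lie in one block. -/
theorem BlockFamily.isFlower [Fintype V] [Fintype I] [Nonempty I] (F : BlockFamily G ℓ)
    (hG : G.Connected) (hend : ∀ i, (F.block i).IsEnd) : IsFlower G ℓ := by
  choose a ha using hend
  have hsing : ∀ i u, (F.block i).proj u ≠ a i → u = (F.block i).emb ((F.block i).proj u) :=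
    fun i u hu => (F.block i).eq_emb_of_extraCard_eq_zero (ha i _ hu) rfl
  -- If the projection to the block `j` were another vertex `b ≠ a j`, then, the fibre of `b` being a
  -- singleton, all vertices of the block `i` would agree, as they have the same projection.
  have hproj : ∀ i j, (F.block j).proj ((F.block i).emb (a i)) = a j := by
    intro i j
    by_cases hij : i = j
    · subst hij; exact (F.block i).proj_emb _
    · by_contra hne
      have h1 := F.proj_emb_of_ne hij (a i) (a i + 1)
      have h2 := hsing j _ hne
      have h3 := hsing j ((F.block i).emb (a i + 1)) (h1 ▸ hne)
      rw [← h1, ← h2] at h3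
      exact Retract.add_one_ne (a i) ((F.block i).emb_injective h3)
  obtain ⟨o⟩ := ‹Nonempty I›
  set c := (F.block o).emb (a o) with hc
  have hcenter : ∀ i, (F.block i).emb (a i) = c := fun i =>
    F.eq_of_proj_eq hG fun j => by rw [hproj, hproj]
  have hother : ∀ i j b, j ≠ i → (F.block j).proj ((F.block i).emb b) = a j := by
    intro i j b hij
    rw [F.proj_emb_of_ne (Ne.symm hij) b (a i), hproj]
  refine ⟨fun u i => (F.block i).proj u - a i, ?_, ?_, ?_⟩
  · intro u v huv
    exact F.eq_of_proj_eq hG fun i => by simpa using congrFun huv i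
  · intro x
    constructor
    · rintro ⟨u, rfl⟩
      by_cases hu : u = c
      · exact ⟨o, fun j _ => by rw [hu]; simp [hc, hproj]⟩
      · have : ∃ i, (F.block i).proj u ≠ a i := by
          by_contra! hall
          exact hu (F.eq_of_proj_eq hG fun j => by rw [hall, hc, hproj])
        obtain ⟨i, hi⟩ := this
        refine ⟨i, fun j hj => ?_⟩
        show (F.block j).proj u - a j = 0
        rw [hsing i u hi, hother i j _ hj, sub_self]
    · rintro ⟨i, hi⟩
      refine ⟨(F.block i).emb (x i + a i), funext fun j => ?_⟩
      by_cases hj : j = i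
      · subst hj; simp [(F.block j).proj_emb]
      · show (F.block j).proj _ - a j = x j
        rw [hother i j _ hj, hi j hj, sub_self]
  · intro u v
    constructor
    · intro huv
      obtain ⟨i, hi, huniq⟩ := F.existsUnique_ne u v huv
      obtain ⟨h1, h2⟩ := (F.block i).collapse u v huv hi
      have h3 := (F.block i).emb_proj_right huv hi
      refine ⟨i, ?_, fun j hj => ?_⟩
      · show (F.block i).proj v - a i = (F.block i).proj u - a i + 1 ∨
          (F.block i).proj u - a i = (F.block i).proj v - a i + 1
        rcases h2 with h2 | h2
        · left; rw [h2]; ring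
        · right; rw [h2]; ring
      · show (F.block j).proj u - a j = 0 ∧ (F.block j).proj v - a j = 0
        rw [← h1, ← h3, hother i j _ hj, hother i j _ hj]
        simp
    · rintro ⟨i, h1, h2⟩
      have key : ∀ w, (∀ j, j ≠ i → (F.block j).proj w - a j = 0) →
          w = (F.block i).emb ((F.block i).proj w) := by
        intro w hw
        refine F.eq_of_proj_eq hG fun j => ?_
        by_cases hj : j = i
        · subst hj; rw [(F.block j).proj_emb]
        · rw [hother i j _ hj, ← sub_eq_zero, hw j hj]
      rw [key u fun j hj => (h2 j hj).1, key v fun j hj => (h2 j hj).2]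
      rcases h1 with h1 | h1
      · have : (F.block i).proj v = (F.block i).proj u + 1 := by linear_combination h1
        rw [this]
        exact (F.block i).adj_emb _
      · have : (F.block i).proj u = (F.block i).proj v + 1 := by linear_combination h1
        rw [this]
        exact ((F.block i).adj_emb _).symm

end Flower

/-! ### The graphs `graphG0` and `graphG5` -/

section Petals

variable {V I J : Type*} {G : SimpleGraph V} {ℓ : I → ℕ}

/-- A graph is a flower if it is the union of edges and cycles `petal i` that meet only in their
common vertex `petal i 0 = c`. -/
theorem isFlower_of_petals (c : V) (petal : ∀ i, ZMod (ℓ i + 2) → V) (h0 : ∀ i, petal i 0 = c)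
    (hinj : ∀ i, Function.Injective (petal i))
    (hdisj : ∀ i j a b, i ≠ j → petal i a = petal j b → a = 0)
    (hsurj : ∀ u, ∃ i a, petal i a = u)
    (hadj : ∀ u v, G.Adj u v ↔ ∃ i a, (u = petal i a ∧ v = petal i (a + 1)) ∨
      (v = petal i a ∧ u = petal i (a + 1))) : IsFlower G ℓ := by
  -- A vertex outside the petal `i` gets the coordinate `0`.
  let ρ : V → ∀ i, ZMod (ℓ i + 2) := fun u i => if h : ∃ a, petal i a = u then h.choose else 0
  have hρ : ∀ i a, ρ (petal i a) i = a := by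
    intro i a
    have h : ∃ b, petal i b = petal i a := ⟨a, rfl⟩
    simp only [ρ, dif_pos h]
    exact hinj i h.choose_spec
  have hρ' : ∀ i j a, j ≠ i → ρ (petal i a) j = 0 := by
    intro i j a hij
    by_cases h : ∃ b, petal j b = petal i a
    · simp only [ρ, dif_pos h]
      exact hdisj j i _ _ hij h.choose_spec
    · simp only [ρ, dif_neg h]
  have hsupp : ∀ i u, (∀ j, j ≠ i → ρ u j = 0) → petal i (ρ u i) = u := by
    intro i u hu
    obtain ⟨j, a, rfl⟩ := hsurj u
    by_cases hij : j = i
    · subst hij; rw [hρ]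
    · have : a = 0 := by rw [← hρ j a, hu j hij]
      rw [hρ' j i a (Ne.symm hij), this, h0, h0]
  have hex : ∀ u, ∃ i, ∀ j, j ≠ i → ρ u j = 0 := by
    intro u
    obtain ⟨i, a, rfl⟩ := hsurj u
    exact ⟨i, fun j hj => hρ' i j a hj⟩
  refine ⟨ρ, ?_, ?_, ?_⟩
  · intro u v huv
    obtain ⟨i, hi⟩ := hex u
    rw [← hsupp i u hi, huv, hsupp i v fun j hj => by rw [← huv]; exact hi j hj]
  · intro x
    constructor
    · rintro ⟨u, rfl⟩
      exact hex u
    · rintro ⟨i, hi⟩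
      refine ⟨petal i (x i), funext fun j => ?_⟩
      by_cases hj : j = i
      · subst hj; rw [hρ]
      · rw [hρ' i j _ hj, hi j hj]
  · intro u v
    rw [hadj]
    constructor
    · rintro ⟨i, a, ⟨rfl, rfl⟩ | ⟨rfl, rfl⟩⟩
      · exact ⟨i, by simp [hρ], fun j hj => ⟨hρ' _ _ _ hj, hρ' _ _ _ hj⟩⟩
      · exact ⟨i, by simp [hρ], fun j hj => ⟨hρ' _ _ _ hj, hρ' _ _ _ hj⟩⟩
    · rintro ⟨i, h1, h2⟩
      have hu := hsupp i u fun j hj => (h2 j hj).1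
      have hv := hsupp i v fun j hj => (h2 j hj).2
      rcases h1 with h1 | h1
      · exact ⟨i, ρ u i, Or.inl ⟨hu.symm, by rw [← h1, hv]⟩⟩
      · exact ⟨i, ρ v i, Or.inr ⟨hv.symm, by rw [← h1, hu]⟩⟩

/-- The lengths (minus two) of the blocks of `graphG0 n t`. -/
def lengthsG0 (n t : ℕ) : Fin t ⊕ Fin (n - (2 * t + 1)) → ℕ :=
  Sum.elim (fun _ => 1) (fun _ => 0)

/-- The lengths (minus two) of the blocks of `graphG5 n t`. -/
def lengthsG5 (n t : ℕ) : Unit ⊕ (Fin (t - 1) ⊕ Fin (n - (2 * t + 2))) → ℕ :=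
  Sum.elim (fun _ => 2) (Sum.elim (fun _ => 1) (fun _ => 0))

theorem isFlower_graphG0 (n t : ℕ) (ht : 1 ≤ t) : IsFlower (graphG0 n t) (lengthsG0 n t) := by
  let petal : ∀ i, ZMod (lengthsG0 n t i + 2) →
      Option (Fin t × Bool ⊕ Fin (n - (2 * t + 1))) := fun i =>
    match i with
    | Sum.inl i => (![none, some (Sum.inl (i, false)), some (Sum.inl (i, true))] : Fin 3 → _)
    | Sum.inr p => (![none, some (Sum.inr p)] : Fin 2 → _)
  -- The last step around a petal leads back to the centre; the modulus is not a literal here, so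
  -- this has to be stated over `ZMod 3` and `ZMod 2` first.
  have wrap3 : ∀ i, petal (Sum.inl i)
      (@id (ZMod (lengthsG0 n t (Sum.inl i) + 2)) (2 : Fin 3) + 1) = none := fun i => by
    show (![none, some (Sum.inl (i, false)), some (Sum.inl (i, true))] : Fin 3 → _)
      (@id (ZMod 3) ((2 : ZMod 3) + 1)) = none
    rfl
  have wrap2 : ∀ p, petal (Sum.inr p)
      (@id (ZMod (lengthsG0 n t (Sum.inr p) + 2)) (1 : Fin 2) + 1) = none := fun p => by
    show (![none, some (Sum.inr p)] : Fin 2 → _) (@id (ZMod 2) ((1 : ZMod 2) + 1)) = none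
    rfl
  have adj_of_eq : ∀ {u v w}, (graphG0 n t).Adj u v → w = v → (graphG0 n t).Adj u w :=
    fun h e => e ▸ h
  refine isFlower_of_petals none petal ?_ ?_ ?_ ?_ ?_
  · rintro (i | p) <;> rfl
  · rintro (i | p)
    · intro (a : Fin 3) (b : Fin 3) h
      fin_cases a <;> fin_cases b <;> first | rfl | simp [petal] at h
    · intro (a : Fin 2) (b : Fin 2) h
      fin_cases a <;> fin_cases b <;> first | rfl | simp [petal] at h
  · rintro (i | p) (j | q)
    · intro (a : Fin 3) (b : Fin 3) hne h
      fin_cases a <;> fin_cases b <;> first | rfl | simp_all [petal]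
    · intro (a : Fin 3) (b : Fin 2) hne h
      fin_cases a <;> fin_cases b <;> first | rfl | simp_all [petal]
    · intro (a : Fin 2) (b : Fin 3) hne h
      fin_cases a <;> fin_cases b <;> first | rfl | simp_all [petal]
    · intro (a : Fin 2) (b : Fin 2) hne h
      fin_cases a <;> fin_cases b <;> first | rfl | simp_all [petal]
  · rintro (_ | ⟨i, _ | _⟩ | p)
    · exact ⟨Sum.inl ⟨0, ht⟩, (0 : Fin 3), rfl⟩
    · exact ⟨Sum.inl i, (1 : Fin 3), rfl⟩
    · exact ⟨Sum.inl i, (2 : Fin 3), rfl⟩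
    · exact ⟨Sum.inr p, (1 : Fin 2), rfl⟩
  · intro u v
    constructor
    · rintro ⟨hne, h⟩
      rcases u with _ | ⟨i, _ | _⟩ | p <;> rcases v with _ | ⟨j, _ | _⟩ | q <;>
        simp at hne h
      · exact ⟨Sum.inl j, (0 : Fin 3), Or.inl ⟨rfl, rfl⟩⟩
      · exact ⟨Sum.inl j, (2 : Fin 3), Or.inr ⟨rfl, (wrap3 j).symm⟩⟩
      · exact ⟨Sum.inr q, (0 : Fin 2), Or.inl ⟨rfl, rfl⟩⟩
      · exact ⟨Sum.inl i, (0 : Fin 3), Or.inr ⟨rfl, rfl⟩⟩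
      · exact absurd (h.elim id Eq.symm) hne
      · obtain rfl : i = j := h.elim id Eq.symm
        exact ⟨Sum.inl i, (1 : Fin 3), Or.inl ⟨rfl, rfl⟩⟩
      · exact ⟨Sum.inl i, (2 : Fin 3), Or.inl ⟨rfl, (wrap3 i).symm⟩⟩
      · obtain rfl : i = j := h.elim id Eq.symm
        exact ⟨Sum.inl i, (1 : Fin 3), Or.inr ⟨rfl, rfl⟩⟩
      · exact absurd (h.elim id Eq.symm) hne
      · exact ⟨Sum.inr p, (0 : Fin 2), Or.inr ⟨rfl, rfl⟩⟩
    · have key : ∀ i a, (graphG0 n t).Adj (petal i a) (petal i (a + 1)) := by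
        rintro (i | p)
        · intro (a : Fin 3)
          fin_cases a
          · show (graphG0 n t).Adj none (some (Sum.inl (i, false)))
            simp [graphG0]
          · show (graphG0 n t).Adj (some (Sum.inl (i, false))) (some (Sum.inl (i, true)))
            simp [graphG0]
          · exact adj_of_eq (show (graphG0 n t).Adj (some (Sum.inl (i, true))) none by
              simp [graphG0]) (wrap3 i)
        · intro (a : Fin 2)
          fin_cases a
          · show (graphG0 n t).Adj none (some (Sum.inr p))
            simp [graphG0]
          · exact adj_of_eq (show (graphG0 n t).Adj (some (Sum.inr p)) none by
              simp [graphG0]) (wrap2 p)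
      rintro ⟨i, a, ⟨rfl, rfl⟩ | ⟨rfl, rfl⟩⟩
      · exact key i a
      · exact (key i a).symm

theorem isFlower_graphG5 (n t : ℕ) : IsFlower (graphG5 n t) (lengthsG5 n t) := by
  let petal : ∀ i, ZMod (lengthsG5 n t i + 2) →
      Option (Fin 3 ⊕ (Fin (t - 1) × Bool ⊕ Fin (n - (2 * t + 2)))) := fun i =>
    match i with
    | Sum.inl _ => (![none, some (Sum.inl 0), some (Sum.inl 1), some (Sum.inl 2)] : Fin 4 → _)
    | Sum.inr (Sum.inl i) =>
      (![none, some (Sum.inr (Sum.inl (i, false))), some (Sum.inr (Sum.inl (i, true)))] : Fin 3 → _)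
    | Sum.inr (Sum.inr p) => (![none, some (Sum.inr (Sum.inr p))] : Fin 2 → _)
  -- The last step around a petal leads back to the centre; the modulus is not a literal here, so
  -- this has to be stated over `ZMod 4`, `ZMod 3` and `ZMod 2` first.
  have wrap4 : ∀ x, petal (Sum.inl x)
      (@id (ZMod (lengthsG5 n t (Sum.inl x) + 2)) (3 : Fin 4) + 1) = none := fun _ => by
    show (![none, some (Sum.inl 0), some (Sum.inl 1), some (Sum.inl 2)] : Fin 4 → _)
      (@id (ZMod 4) ((3 : ZMod 4) + 1)) = none
    rfl
  have wrap3 : ∀ i, petal (Sum.inr (Sum.inl i))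
      (@id (ZMod (lengthsG5 n t (Sum.inr (Sum.inl i)) + 2)) (2 : Fin 3) + 1) = none := fun i => by
    show (![none, some (Sum.inr (Sum.inl (i, false))),
      some (Sum.inr (Sum.inl (i, true)))] : Fin 3 → _) (@id (ZMod 3) ((2 : ZMod 3) + 1)) = none
    rfl
  have wrap2 : ∀ p, petal (Sum.inr (Sum.inr p))
      (@id (ZMod (lengthsG5 n t (Sum.inr (Sum.inr p)) + 2)) (1 : Fin 2) + 1) = none := fun p => by
    show (![none, some (Sum.inr (Sum.inr p))] : Fin 2 → _) (@id (ZMod 2) ((1 : ZMod 2) + 1)) = none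
    rfl
  have adj_of_eq : ∀ {u v w}, (graphG5 n t).Adj u v → w = v → (graphG5 n t).Adj u w :=
    fun h e => e ▸ h
  refine isFlower_of_petals none petal ?_ ?_ ?_ ?_ ?_
  · rintro (_ | i | p) <;> rfl
  · rintro (_ | i | p)
    · intro (a : Fin 4) (b : Fin 4) h
      fin_cases a <;> fin_cases b <;> first | rfl | simp [petal] at h
    · intro (a : Fin 3) (b : Fin 3) h
      fin_cases a <;> fin_cases b <;> first | rfl | simp [petal] at h
    · intro (a : Fin 2) (b : Fin 2) h
      fin_cases a <;> fin_cases b <;> first | rfl | simp [petal] at h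
  · rintro (_ | i | p) (_ | j | q)
    · exact fun _ _ hne => absurd rfl hne
    · intro (a : Fin 4) (b : Fin 3) hne h
      fin_cases a <;> fin_cases b <;> first | rfl | simp_all [petal]
    · intro (a : Fin 4) (b : Fin 2) hne h
      fin_cases a <;> fin_cases b <;> first | rfl | simp_all [petal]
    · intro (a : Fin 3) (b : Fin 4) hne h
      fin_cases a <;> fin_cases b <;> first | rfl | simp_all [petal]
    · intro (a : Fin 3) (b : Fin 3) hne h
      fin_cases a <;> fin_cases b <;> first | rfl | simp_all [petal]
    · intro (a : Fin 3) (b : Fin 2) hne h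
      fin_cases a <;> fin_cases b <;> first | rfl | simp_all [petal]
    · intro (a : Fin 2) (b : Fin 4) hne h
      fin_cases a <;> fin_cases b <;> first | rfl | simp_all [petal]
    · intro (a : Fin 2) (b : Fin 3) hne h
      fin_cases a <;> fin_cases b <;> first | rfl | simp_all [petal]
    · intro (a : Fin 2) (b : Fin 2) hne h
      fin_cases a <;> fin_cases b <;> first | rfl | simp_all [petal]
  · rintro (_ | k | ⟨i, _ | _⟩ | p)
    · exact ⟨Sum.inl (), (0 : Fin 4), rfl⟩
    · fin_cases k
      · exact ⟨Sum.inl (), (1 : Fin 4), rfl⟩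
      · exact ⟨Sum.inl (), (2 : Fin 4), rfl⟩
      · exact ⟨Sum.inl (), (3 : Fin 4), rfl⟩
    · exact ⟨Sum.inr (Sum.inl i), (1 : Fin 3), rfl⟩
    · exact ⟨Sum.inr (Sum.inl i), (2 : Fin 3), rfl⟩
    · exact ⟨Sum.inr (Sum.inr p), (1 : Fin 2), rfl⟩
  · have key : ∀ i a, (graphG5 n t).Adj (petal i a) (petal i (a + 1)) := by
      rintro (_ | i | p)
      · intro (a : Fin 4)
        fin_cases a
        · show (graphG5 n t).Adj none (some (Sum.inl 0))
          simp [graphG5]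
        · show (graphG5 n t).Adj (some (Sum.inl 0)) (some (Sum.inl 1))
          simp [graphG5]
        · show (graphG5 n t).Adj (some (Sum.inl 1)) (some (Sum.inl 2))
          simp [graphG5]
        · exact adj_of_eq (show (graphG5 n t).Adj (some (Sum.inl 2)) none by
            simp [graphG5]) (wrap4 ())
      · intro (a : Fin 3)
        fin_cases a
        · show (graphG5 n t).Adj none (some (Sum.inr (Sum.inl (i, false))))
          simp [graphG5]
        · show (graphG5 n t).Adj (some (Sum.inr (Sum.inl (i, false))))
            (some (Sum.inr (Sum.inl (i, true))))
          simp [graphG5]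
        · exact adj_of_eq (show (graphG5 n t).Adj (some (Sum.inr (Sum.inl (i, true)))) none by
            simp [graphG5]) (wrap3 i)
      · intro (a : Fin 2)
        fin_cases a
        · show (graphG5 n t).Adj none (some (Sum.inr (Sum.inr p)))
          simp [graphG5]
        · exact adj_of_eq (show (graphG5 n t).Adj (some (Sum.inr (Sum.inr p))) none by
            simp [graphG5]) (wrap2 p)
    have hrel : ∀ u v, (graphG5 n t).Adj u v → ∃ i a, (u = petal i a ∧ v = petal i (a + 1)) ∨
        (v = petal i a ∧ u = petal i (a + 1)) := by
      rintro u v ⟨hne, h⟩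
      rcases u with _ | k | ⟨i, _ | _⟩ | p
      · rcases v with _ | k | ⟨j, _ | _⟩ | q
        · exact absurd rfl hne
        · fin_cases k
          · exact ⟨Sum.inl (), (0 : Fin 4), Or.inl ⟨rfl, rfl⟩⟩
          · simp at h
          · exact ⟨Sum.inl (), (3 : Fin 4), Or.inr ⟨rfl, (wrap4 ()).symm⟩⟩
        · exact ⟨Sum.inr (Sum.inl j), (0 : Fin 3), Or.inl ⟨rfl, rfl⟩⟩
        · exact ⟨Sum.inr (Sum.inl j), (2 : Fin 3), Or.inr ⟨rfl, (wrap3 j).symm⟩⟩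
        · exact ⟨Sum.inr (Sum.inr q), (0 : Fin 2), Or.inl ⟨rfl, rfl⟩⟩
      · rcases v with _ | l | ⟨j, _ | _⟩ | q
        · fin_cases k
          · exact ⟨Sum.inl (), (0 : Fin 4), Or.inr ⟨rfl, rfl⟩⟩
          · simp at h
          · exact ⟨Sum.inl (), (3 : Fin 4), Or.inl ⟨rfl, (wrap4 ()).symm⟩⟩
        · fin_cases k <;> fin_cases l <;> simp at h
          · exact ⟨Sum.inl (), (1 : Fin 4), Or.inl ⟨rfl, rfl⟩⟩
          · exact ⟨Sum.inl (), (1 : Fin 4), Or.inr ⟨rfl, rfl⟩⟩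
          · exact ⟨Sum.inl (), (2 : Fin 4), Or.inl ⟨rfl, rfl⟩⟩
          · exact ⟨Sum.inl (), (2 : Fin 4), Or.inr ⟨rfl, rfl⟩⟩
        all_goals simp at h
      · rcases v with _ | l | ⟨j, _ | _⟩ | q <;> simp at hne h
        · exact ⟨Sum.inr (Sum.inl i), (0 : Fin 3), Or.inr ⟨rfl, rfl⟩⟩
        · exact absurd (h.elim id Eq.symm) hne
        · obtain rfl : i = j := h.elim id Eq.symm
          exact ⟨Sum.inr (Sum.inl i), (1 : Fin 3), Or.inl ⟨rfl, rfl⟩⟩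
      · rcases v with _ | l | ⟨j, _ | _⟩ | q <;> simp at hne h
        · exact ⟨Sum.inr (Sum.inl i), (2 : Fin 3), Or.inl ⟨rfl, (wrap3 i).symm⟩⟩
        · obtain rfl : i = j := h.elim id Eq.symm
          exact ⟨Sum.inr (Sum.inl i), (1 : Fin 3), Or.inr ⟨rfl, rfl⟩⟩
        · exact absurd (h.elim id Eq.symm) hne
      · rcases v with _ | l | ⟨j, _ | _⟩ | q <;> simp at hne h
        exact ⟨Sum.inr (Sum.inr p), (0 : Fin 2), Or.inr ⟨rfl, rfl⟩⟩
    intro u v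
    refine ⟨hrel u v, ?_⟩
    rintro ⟨i, a, ⟨rfl, rfl⟩ | ⟨rfl, rfl⟩⟩
    · exact key i a
    · exact (key i a).symm

end Petals

section Counting

variable {I J : Type*}

lemma exists_equiv_comp_eq [Fintype I] [Fintype J] (ℓ : I → ℕ) (ℓ' : J → ℕ)
    (h : ∀ x, (univ.filter fun i => ℓ i = x).card = (univ.filter fun j => ℓ' j = x).card) :
    ∃ e : J ≃ I, ℓ ∘ e = ℓ' := by
  let e : ∀ x, {j // ℓ' j = x} ≃ {i // ℓ i = x} := fun x => Fintype.equivOfCardEq (by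
    rw [Fintype.card_subtype, Fintype.card_subtype, h])
  refine ⟨(Equiv.sigmaFiberEquiv ℓ').symm.trans ((Equiv.sigmaCongrRight e).trans
    (Equiv.sigmaFiberEquiv ℓ)), funext fun j => ?_⟩
  exact (e (ℓ' j) ⟨j, rfl⟩).2

/-- A flower with blocks of the same lengths as another flower is isomorphic to it. -/
lemma IsFlower.nonempty_iso_of_card {V W : Type*} [Fintype I] [Fintype J] {G : SimpleGraph V}
    {H : SimpleGraph W} {ℓ : I → ℕ} {ℓ' : J → ℕ} (hG : IsFlower G ℓ) (hH : IsFlower H ℓ')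
    (h : ∀ x, (univ.filter fun i => ℓ i = x).card = (univ.filter fun j => ℓ' j = x).card) :
    Nonempty (G ≃g H) := by
  obtain ⟨e, rfl⟩ := exists_equiv_comp_eq ℓ ℓ' h
  exact (hG.reindex e).nonempty_iso hH

end Counting

/-! ### Cycles of a cactus -/

open SimpleGraph

section Nonseparable

variable {V : Type*} {G : SimpleGraph V}

lemma preconnected_of_forall_walk {H : G.Subgraph} (z : V)
    (h : ∀ x ∈ H.verts, ∃ p : G.Walk z x, p.toSubgraph ≤ H) : H.Preconnected := by
  rw [Subgraph.preconnected_iff_forall_exists_walk_subgraph]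
  intro x y hx hy
  obtain ⟨p, hp⟩ := h x hx
  obtain ⟨q, hq⟩ := h y hy
  refine ⟨p.reverse.append q, ?_⟩
  rw [Walk.toSubgraph_append, Walk.toSubgraph_reverse]
  exact sup_le hp hq

lemma preconnected_sup {A B : G.Subgraph} (hA : A.Preconnected) (hB : B.Preconnected) {z : V}
    (hzA : z ∈ A.verts) (hzB : z ∈ B.verts) : (A ⊔ B).Preconnected := by
  rw [Subgraph.preconnected_iff_forall_exists_walk_subgraph] at hA hB
  refine preconnected_of_forall_walk z fun x hx => ?_
  rcases hx with hx | hx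
  · obtain ⟨p, hp⟩ := hA hzA hx
    exact ⟨p, hp.trans le_sup_left⟩
  · obtain ⟨p, hp⟩ := hB hzB hx
    exact ⟨p, hp.trans le_sup_right⟩

lemma deleteVerts_eq_self {A : G.Subgraph} {v : V} (h : v ∉ A.verts) : A.deleteVerts {v} = A := by
  rw [← Subgraph.deleteVerts_inter_verts_left_eq, Set.inter_singleton_eq_empty.2 h,
    Subgraph.deleteVerts_empty]

lemma IsNonseparable.preconnected_deleteVerts {A : G.Subgraph} (hA : IsNonseparable A) (v : V) :
    (A.deleteVerts {v}).Preconnected := by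
  by_cases h : v ∈ A.verts
  · exact hA.2 v h
  · rw [deleteVerts_eq_self h]
    exact hA.1.preconnected

/-- Two subgraphs without cut vertices that share two vertices have a union without cut
vertices: whichever vertex is deleted, a common vertex remains. -/
lemma IsNonseparable.sup {A B : G.Subgraph} (hA : IsNonseparable A) (hB : IsNonseparable B)
    {x y : V} (hxy : x ≠ y) (hxA : x ∈ A.verts) (hxB : x ∈ B.verts) (hyA : y ∈ A.verts)
    (hyB : y ∈ B.verts) : IsNonseparable (A ⊔ B) := by
  refine ⟨Subgraph.connected_iff.2
    ⟨preconnected_sup hA.1.preconnected hB.1.preconnected hxA hxB, ⟨x, Or.inl hxA⟩⟩,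
    fun v _ => ?_⟩
  have hsup : (A ⊔ B).deleteVerts {v} = A.deleteVerts {v} ⊔ B.deleteVerts {v} := by
    ext a b
    · simp only [Subgraph.deleteVerts_verts, Subgraph.verts_sup, Set.union_sdiff_distrib]
    · have := @Subgraph.edge_vert _ _ A a b
      have := @Subgraph.edge_vert _ _ B a b
      have := fun h => @Subgraph.edge_vert _ _ A b a (Subgraph.Adj.symm h)
      have := fun h => @Subgraph.edge_vert _ _ B b a (Subgraph.Adj.symm h)
      simp only [Subgraph.deleteVerts_adj, Subgraph.sup_adj, Subgraph.verts_sup, Set.mem_union]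
      tauto
  rw [hsup]
  by_cases hxv : x = v
  · have hyv : y ≠ v := fun h => hxy (hxv.trans h.symm)
    exact preconnected_sup (hA.preconnected_deleteVerts v) (hB.preconnected_deleteVerts v)
      (z := y) ⟨hyA, hyv⟩ ⟨hyB, hyv⟩
  · exact preconnected_sup (hA.preconnected_deleteVerts v) (hB.preconnected_deleteVerts v)
      (z := x) ⟨hxA, hxv⟩ ⟨hxB, hxv⟩

lemma IsCycleSubgraph.isNonseparable {C : G.Subgraph} (hC : IsCycleSubgraph C) :
    IsNonseparable C := by
  obtain ⟨u, c, hc, rfl⟩ := hC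
  refine ⟨c.toSubgraph_connected, fun v hv => ?_⟩
  rw [Walk.mem_verts_toSubgraph] at hv
  rw [← c.toSubgraph_rotate hv]
  have hc' := hc.rotate hv
  generalize c.rotate v hv = d at hc'
  cases d with
  | nil => exact absurd hc' (by simp)
  | @cons _ w _ h p =>
    rw [Walk.cons_isCycle_iff] at hc'
    refine preconnected_of_forall_walk w fun x hx => ?_
    obtain ⟨hx1, hx2⟩ := hx
    have hxv : v ≠ x := fun e => hx2 e.symm
    have hxp : x ∈ p.support := by
      rw [Walk.mem_verts_toSubgraph, Walk.support_cons, List.mem_cons] at hx1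
      exact hx1.resolve_left fun e => hxv e.symm
    have hnot := Walk.endpoint_notMem_support_takeUntil hc'.1 hxp hxv
    have hle : (p.takeUntil x hxp).toSubgraph ≤ (Walk.cons h p).toSubgraph := by
      have e : p.toSubgraph =
          (p.takeUntil x hxp).toSubgraph ⊔ (p.dropUntil x hxp).toSubgraph := by
        rw [← Walk.toSubgraph_append, Walk.take_spec]
      rw [Walk.toSubgraph, e]
      exact le_sup_left.trans le_sup_right
    have hv' : ∀ a ∈ (p.takeUntil x hxp).toSubgraph.verts, a ∉ ({v} : Set V) := by
      rintro a ha rfl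
      exact hnot ((Walk.mem_verts_toSubgraph _).1 ha)
    refine ⟨p.takeUntil x hxp, ⟨fun a ha => ⟨hle.1 ha, hv' a ha⟩, fun a b hab => ?_⟩⟩
    rw [Subgraph.deleteVerts_adj]
    have ha := Subgraph.edge_vert _ hab
    have hb := Subgraph.edge_vert _ hab.symm
    exact ⟨hle.1 ha, hv' a ha, hle.1 hb, hv' b hb, hle.2 hab⟩

lemma IsCycleSubgraph.ncard_neighborSet {C : G.Subgraph} (hC : IsCycleSubgraph C) {v : V}
    (hv : v ∈ C.verts) : (C.neighborSet v).ncard = 2 := by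
  obtain ⟨u, c, hc, rfl⟩ := hC
  exact hc.ncard_neighborSet_toSubgraph_eq_two ((Walk.mem_verts_toSubgraph _).1 hv)

/-- A cycle contains no other cycle: both are 2-regular and the larger one is connected. -/
lemma IsCycleSubgraph.eq_of_le {C D : G.Subgraph} (hC : IsCycleSubgraph C)
    (hD : IsCycleSubgraph D) (h : C ≤ D) : C = D := by
  have hnb : ∀ v ∈ C.verts, C.neighborSet v = D.neighborSet v := by
    intro v hv
    refine Set.eq_of_subset_of_ncard_le (fun w hw => h.2 hw) ?_ ?_
    · rw [hC.ncard_neighborSet hv, hD.ncard_neighborSet (h.1 hv)]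
    · exact Set.finite_of_ncard_ne_zero (by rw [hD.ncard_neighborSet (h.1 hv)]; norm_num)
  have hadj : ∀ v ∈ C.verts, ∀ w, D.Adj v w → C.Adj v w := by
    intro v hv w hw
    have : w ∈ D.neighborSet v := hw
    rwa [← hnb v hv] at this
  have hconn := hD.isNonseparable.1
  obtain ⟨z, hz⟩ := hC.isNonseparable.1.nonempty
  have hwalk : ∀ {x y : D.verts}, D.coe.Walk x y → x.1 ∈ C.verts → y.1 ∈ C.verts := by
    intro x y p
    induction p with
    | nil => exact id
    | cons hab _ ih => exact fun ha => ih (C.edge_vert (hadj _ ha _ hab).symm)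
  have hverts : ∀ v ∈ D.verts, v ∈ C.verts := by
    intro v hv
    obtain ⟨p⟩ := hconn.preconnected.coe ⟨z, h.1 hz⟩ ⟨v, hv⟩
    exact hwalk p hz
  exact le_antisymm h ⟨hverts, fun v w hvw => hadj v (hverts v (D.edge_vert hvw)) w hvw⟩

/-- Two cycles of a cactus that share two vertices are equal, because both lie in the same block. -/
lemma IsCactus.cycle_unique [Finite V] (hG : IsCactus G) {C D : G.Subgraph}
    (hC : IsCycleSubgraph C) (hD : IsCycleSubgraph D) {x y : V} (hxy : x ≠ y)
    (hxC : x ∈ C.verts) (hxD : x ∈ D.verts) (hyC : y ∈ C.verts) (hyD : y ∈ D.verts) : C = D := by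
  have hsup := hC.isNonseparable.sup hD.isNonseparable hxy hxC hxD hyC hyD
  obtain ⟨B, hle, hB⟩ := Finite.exists_le_maximal hsup
  rcases hG.2 B hB with ⟨u, v, huv, rfl⟩ | hcyc
  · exfalso
    have h1 : x ∈ (G.subgraphOfAdj huv).verts := hle.1 (Or.inl hxC)
    have h2 : (C.neighborSet x) ⊆ (G.subgraphOfAdj huv).neighborSet x := fun w hw =>
      hle.2 (Or.inl hw)
    have h3 : ((G.subgraphOfAdj huv).neighborSet x).ncard ≤ 1 := by
      rcases h1 with rfl | rfl
      · rw [neighborSet_fst_subgraphOfAdj, Set.ncard_singleton]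
      · rw [neighborSet_snd_subgraphOfAdj, Set.ncard_singleton]
    have h4 := Set.ncard_le_ncard h2 (Set.toFinite _)
    rw [hC.ncard_neighborSet hxC] at h4
    omega
  · rw [hC.eq_of_le hcyc (le_sup_left.trans hle), hD.eq_of_le hcyc (le_sup_right.trans hle)]

/-- Distinct vertices of a cycle `C` of a cactus are separated by deleting the edges of `C`.
Otherwise a path outside `C` from `x` to `y`, together with one of the two arcs of `C` between `x`
and `y`, would contain a cycle through the first edge of this arc that avoids the other arc. -/
lemma IsCactus.eq_of_reachable_deleteEdges [Finite V] (hG : IsCactus G) {C : G.Subgraph}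
    (hC : IsCycleSubgraph C) {x y : V} (hx : x ∈ C.verts) (hy : y ∈ C.verts)
    (h : (G.deleteEdges C.edgeSet).Reachable x y) : x = y := by
  by_contra hxy
  have hC' := hC
  obtain ⟨u, c₀, hc₀, rfl⟩ := hC
  rw [Walk.mem_verts_toSubgraph] at hx
  have hc := hc₀.rotate hx
  have hsub := c₀.toSubgraph_rotate hx
  generalize c₀.rotate x hx = c at hc hsub
  rw [← hsub] at hC' hy h
  rw [Walk.mem_verts_toSubgraph] at hy
  have hspec := c.take_spec hy
  generalize hA : c.takeUntil y hy = A at hspec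
  generalize hB : c.dropUntil y hy = B at hspec
  have hnodup : c.edges.Nodup := hc.isTrail.edges_nodup
  rw [← hspec, Walk.edges_append] at hnodup
  -- `A` and `B` are the two arcs of the cycle from `x` to `y` and back.
  have hdisj := (List.nodup_append'.1 hnodup).2.2
  have hBmem : ∃ e, e ∈ B.edges := by
    cases B with
    | nil => exact absurd rfl hxy
    | cons h p => exact ⟨_, by rw [Walk.edges_cons]; exact List.mem_cons_self⟩
  obtain ⟨e, he⟩ := hBmem
  cases A with
  | nil => exact hxy rfl
  | @cons _ z _ hxz A' =>
    rw [Walk.edges_cons] at hnodup hdisj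
    have hnd' := (List.nodup_cons.1 (List.nodup_append'.1 hnodup).1).1
    -- The first edge `s(x, z)` of `A` is no bridge after the edges of `B` have been deleted: follow `A`
    -- from `z` to `y`, then the connection outside the cycle from `y` back to `x`.
    set H := G.deleteEdges {e | e ∈ B.edges} with hH
    have hHadj : H.Adj x z := by
      rw [hH, deleteEdges_adj]
      exact ⟨hxz, fun hm => hdisj (List.mem_cons_self) hm⟩
    have hzx : s(x, z) ∈ c.edges := by
      rw [← hspec, Walk.edges_append, Walk.edges_cons]; simp
    have hreach : (H.deleteEdges {s(x, z)}).Reachable x z := by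
      have h1 : (H.deleteEdges {s(x, z)}).Reachable z y := by
        refine ⟨A'.transfer _ fun f hf => ?_⟩
        rw [edgeSet_deleteEdges, hH, edgeSet_deleteEdges]
        refine ⟨⟨A'.edges_subset_edgeSet hf, fun hm => hdisj (List.mem_cons_of_mem _ hf) hm⟩, ?_⟩
        rintro rfl
        exact hnd' hf
      have h2 : (H.deleteEdges {s(x, z)}).Reachable x y := by
        refine h.mono fun a b hab => ?_
        rw [deleteEdges_adj, Walk.mem_edges_toSubgraph] at hab
        rw [deleteEdges_adj, hH, deleteEdges_adj]
        refine ⟨⟨hab.1, fun hm => hab.2 ?_⟩, fun hm => hab.2 ?_⟩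
        · rw [← hspec, Walk.edges_append]
          exact List.mem_append_right _ hm
        · rw [Set.mem_singleton_iff.1 hm]
          exact hzx
      exact h2.trans h1.symm
    obtain ⟨w, p, hp, hpe⟩ := adj_and_reachable_delete_edges_iff_exists_cycle.1 ⟨hHadj, hreach⟩
    have hle : H ≤ G := deleteEdges_le _
    have hD : IsCycleSubgraph (p.mapLe hle).toSubgraph := ⟨w, _, hp.mapLe hle, rfl⟩
    have hDe : s(x, z) ∈ (p.mapLe hle).toSubgraph.edgeSet := by
      rw [Walk.mem_edges_toSubgraph, Walk.edges_mapLe_eq_edges]; exact hpe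
    have hCe : s(x, z) ∈ c.toSubgraph.edgeSet := by rwa [Walk.mem_edges_toSubgraph]
    rw [Subgraph.mem_edgeSet] at hDe hCe
    have heq := hG.cycle_unique hC' hD hxz.ne (Subgraph.edge_vert _ hCe)
      (Subgraph.edge_vert _ hDe) (Subgraph.edge_vert _ hCe.symm) (Subgraph.edge_vert _ hDe.symm)
    have h1 : e ∈ c.toSubgraph.edgeSet := by
      rw [Walk.mem_edges_toSubgraph, ← hspec, Walk.edges_append]
      exact List.mem_append_right _ he
    rw [heq, Walk.mem_edges_toSubgraph, Walk.edges_mapLe_eq_edges] at h1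
    have h2 := p.edges_subset_edgeSet h1
    rw [hH, edgeSet_deleteEdges] at h2
    exact h2.2 he

end Nonseparable

/-! ### The block decomposition of a cactus -/

section CactusBlocks

variable {V : Type*} {G : SimpleGraph V}

/-- The projection of a cactus to one of its cycles. -/
lemma IsCactus.exists_retract_of_cycle [Finite V] (hG : IsCactus G) {C : G.Subgraph}
    (hC : IsCycleSubgraph C) : ∃ ℓ : ℕ, ℓ ≠ 0 ∧ ∃ R : Retract G ℓ,
      ∀ x y, G.Adj x y → (R.proj x ≠ R.proj y ↔ C.Adj x y) := by
  have hsep := fun x y => @IsCactus.eq_of_reachable_deleteEdges _ _ _ hG _ hC x y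
  obtain ⟨u, c, hc, rfl⟩ := hC
  obtain ⟨ℓ, hℓ⟩ : ∃ ℓ, c.length = ℓ + 2 := ⟨c.length - 2, by have := hc.three_le_length; omega⟩
  have hℓ0 : ℓ ≠ 0 := by have := hc.three_le_length; omega
  have : Fact (1 < ℓ + 2) := ⟨by omega⟩
  let emb : ZMod (ℓ + 2) → V := fun a => c.getVert a.val
  have hlt : ∀ a : ZMod (ℓ + 2), a.val < ℓ + 2 := fun a => ZMod.val_lt a
  have hinj : Function.Injective emb := by
    intro a b hab
    have ha := hlt a
    have hb := hlt b
    exact ZMod.val_injective _ (hc.getVert_injOn' (by simp; omega) (by simp; omega) hab)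
  have hsucc : ∀ a, emb (a + 1) = c.getVert (a.val + 1) := by
    intro a
    by_cases h : a.val + 1 < ℓ + 2
    · have : (a + 1).val = a.val + 1 := by
        rw [ZMod.val_add_of_lt] <;> simp [ZMod.val_one, h]
      simp only [emb, this]
    · have h1 : a.val + 1 = ℓ + 2 := by have := hlt a; omega
      have h0 : a + 1 = 0 := by
        have : ((a.val + 1 : ℕ) : ZMod (ℓ + 2)) = 0 := by rw [h1]; simp
        simpa using this
      have h2 : c.getVert (a.val + 1) = u := by
        rw [show a.val + 1 = c.length by omega, Walk.getVert_length]
      rw [h0, h2]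
      simp [emb]
  have hadjC : ∀ a, c.toSubgraph.Adj (emb a) (emb (a + 1)) := by
    intro a
    rw [Walk.toSubgraph_adj_iff]
    exact ⟨a.val, by rw [hsucc], by rw [hℓ]; exact hlt a⟩
  have hCadj : ∀ x y, c.toSubgraph.Adj x y →
      ∃ a, (x = emb a ∧ y = emb (a + 1)) ∨ (y = emb a ∧ x = emb (a + 1)) := by
    intro x y hxy
    obtain ⟨i, hi, hlen⟩ := (Walk.toSubgraph_adj_iff c).1 hxy
    have hv : ((i : ℕ) : ZMod (ℓ + 2)).val = i := ZMod.val_natCast_of_lt (by omega)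
    refine ⟨(i : ZMod (ℓ + 2)), ?_⟩
    rw [hsucc]
    simp only [emb, hv]
    rcases Sym2.eq_iff.1 hi with ⟨h1, h2⟩ | ⟨h1, h2⟩
    · exact Or.inl ⟨h1.symm, h2.symm⟩
    · exact Or.inr ⟨h1.symm, h2.symm⟩
  have hverts : ∀ a, emb a ∈ c.toSubgraph.verts := fun a => Subgraph.edge_vert _ (hadjC a)
  set G' := G.deleteEdges c.toSubgraph.edgeSet with hG'
  have hG'adj : ∀ x y, G.Adj x y → ¬ c.toSubgraph.Adj x y → G'.Adj x y := by
    intro x y h1 h2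
    rw [hG', deleteEdges_adj, Subgraph.mem_edgeSet]
    exact ⟨h1, h2⟩
  have hwalk : ∀ {x z}, G.Walk x z → (∃ a, G'.Reachable z (emb a)) →
      ∃ a, G'.Reachable x (emb a) := by
    intro x z p hz
    induction p with
    | nil => exact hz
    | @cons x y _ h p ih =>
      by_cases hxy : c.toSubgraph.Adj x y
      · obtain ⟨a, ⟨rfl, -⟩ | ⟨-, rfl⟩⟩ := hCadj x y hxy
        · exact ⟨a, Reachable.refl _⟩
        · exact ⟨a + 1, Reachable.refl _⟩
      · obtain ⟨a, ha⟩ := ih hz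
        exact ⟨a, (hG'adj x y h hxy).reachable.trans ha⟩
  have hex : ∀ x, ∃ a, G'.Reachable x (emb a) := by
    intro x
    obtain ⟨p⟩ := hG.1.preconnected x (emb 0)
    exact hwalk p ⟨0, Reachable.refl _⟩
  choose proj hproj using hex
  -- Once the edges of the cycle are deleted, `x` is still connected to exactly one vertex of it.
  have huniq : ∀ x a, G'.Reachable x (emb a) → proj x = a := fun x a h =>
    hinj (hsep _ _ (hverts _) (hverts _) ((hproj x).symm.trans h))
  have hpe : ∀ a, proj (emb a) = a := fun a => huniq _ _ (Reachable.refl _)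
  have hcol : ∀ x y, G.Adj x y → proj x ≠ proj y → c.toSubgraph.Adj x y := by
    intro x y hxy hne
    by_contra h
    exact hne (huniq x _ ((hG'adj x y hxy h).reachable.trans (hproj y)))
  refine ⟨ℓ, hℓ0, ⟨emb, proj, hpe, fun a => (hadjC a).adj_sub, fun x y hxy hne => ?_⟩,
    fun x y hxy => ⟨hcol x y hxy, fun h => ?_⟩⟩
  · obtain ⟨a, ⟨rfl, rfl⟩ | ⟨rfl, rfl⟩⟩ := hCadj x y (hcol x y hxy hne)
    · simp [hpe]
    · simp [hpe]
  · show proj x ≠ proj y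
    obtain ⟨a, ⟨rfl, rfl⟩ | ⟨rfl, rfl⟩⟩ := hCadj x y h
    · rw [hpe, hpe]
      exact (Retract.add_one_ne a).symm
    · rw [hpe, hpe]
      exact Retract.add_one_ne a

/-- The projection of a graph to one of its bridges `s(u, v)`: deleting the bridge splits off the
vertices that can be reached from `u`. -/
lemma exists_retract_of_isBridge (e : Sym2 V) (he : e ∈ G.edgeSet) (hb : G.IsBridge e) :
    ∃ R : Retract G 0, ∀ x y, G.Adj x y → (R.proj x ≠ R.proj y ↔ s(x, y) = e) := by
  induction e with
  | h u v =>
    rw [isBridge_iff] at hb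
    rw [mem_edgeSet] at he
    set G' := G.deleteEdges {s(u, v)} with hG'
    let proj : V → ZMod 2 := fun x => if G'.Reachable u x then 0 else 1
    let emb : ZMod 2 → V := fun a => if a = 0 then u else v
    have hu : proj u = 0 := if_pos (Reachable.refl _)
    have hv : proj v = 1 := if_neg hb
    have hcol : ∀ x y, G.Adj x y → proj x ≠ proj y → s(x, y) = s(u, v) := by
      intro x y hxy hne
      by_contra h
      have hadj : G'.Adj x y := by
        rw [hG', deleteEdges_adj]
        exact ⟨hxy, h⟩
      refine hne ?_
      have : G'.Reachable u x ↔ G'.Reachable u y :=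
        ⟨fun h => h.trans hadj.reachable, fun h => h.trans hadj.symm.reachable⟩
      simp only [proj, this]
    have hd : ∀ a : ZMod 2, a = 0 ∨ a = 1 := by decide
    refine ⟨⟨emb, proj, fun a => ?_, fun a => ?_, fun x y hxy hne => ?_⟩,
      fun x y hxy => ⟨hcol x y hxy, fun h => ?_⟩⟩
    · rcases hd a with rfl | rfl
      · simpa [emb] using hu
      · simpa [emb] using hv
    · rcases hd a with rfl | rfl
      · simpa [emb] using he
      · have : (1 : ZMod 2) + 1 = 0 := by decide
        show G.Adj (emb (1 : ZMod 2)) (emb ((1 : ZMod 2) + 1))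
        rw [this]
        simpa [emb] using he.symm
    · rcases Sym2.eq_iff.1 (hcol x y hxy hne) with ⟨rfl, rfl⟩ | ⟨rfl, rfl⟩
      · rw [hu, hv]
        exact ⟨by simp [emb], Or.inl (by decide)⟩
      · rw [hu, hv]
        exact ⟨by simp [emb], Or.inl (by decide)⟩
    · show proj x ≠ proj y
      rcases Sym2.eq_iff.1 h with ⟨rfl, rfl⟩ | ⟨rfl, rfl⟩
      · rw [hu, hv]; decide
      · rw [hu, hv]; decide

/-- The edges of a cactus decompose into its cycles and its bridges. -/
theorem IsCact.exists_blockFamily.{u} {V : Type u} [Fintype V] {G : SimpleGraph V} {n t : ℕ}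
    (hG : IsCact n t G) : ∃ (I : Type u) (_ : Fintype I) (ℓ : I → ℕ) (_ : BlockFamily G ℓ),
      (univ.filter fun i => ℓ i ≠ 0).card = t := by
  obtain ⟨hcactus, -, ht⟩ := hG
  have h1 : ∀ C : {C : G.Subgraph // IsCycleSubgraph C}, ∃ ℓ : ℕ, ℓ ≠ 0 ∧ ∃ R : Retract G ℓ,
      ∀ x y, G.Adj x y → (R.proj x ≠ R.proj y ↔ C.1.Adj x y) := fun C =>
    hcactus.exists_retract_of_cycle C.2
  have h2 : ∀ e : {e : Sym2 V // e ∈ G.edgeSet ∧ G.IsBridge e}, ∃ R : Retract G 0,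
      ∀ x y, G.Adj x y → (R.proj x ≠ R.proj y ↔ s(x, y) = e.1) := fun e =>
    exists_retract_of_isBridge e.1 e.2.1 e.2.2
  choose ℓ hℓ R hR using h1
  choose R' hR' using h2
  have hfin : Fintype {C : G.Subgraph // IsCycleSubgraph C} := Fintype.ofFinite _
  have hcyc : ∀ {x y}, G.Adj x y → (G.IsBridge s(x, y) ↔
      ¬ ∃ C : G.Subgraph, IsCycleSubgraph C ∧ C.Adj x y) := by
    intro x y hxy
    rw [isBridge_iff_forall_cycle_notMem (by simpa using hxy)]
    constructor
    · rintro h ⟨_, ⟨u, c, hc, rfl⟩, hadj⟩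
      rw [← Subgraph.mem_edgeSet, Walk.mem_edges_toSubgraph] at hadj
      exact h c hc hadj
    · intro h u c hc hmem
      refine h ⟨c.toSubgraph, ⟨u, c, hc, rfl⟩, ?_⟩
      rwa [← Subgraph.mem_edgeSet, Walk.mem_edges_toSubgraph]
  refine ⟨{C : G.Subgraph // IsCycleSubgraph C} ⊕ {e : Sym2 V // e ∈ G.edgeSet ∧ G.IsBridge e},
    inferInstance, Sum.elim ℓ (fun _ => 0), ⟨fun i => match i with
      | Sum.inl C => R C
      | Sum.inr e => R' e, fun x y hxy => ?_⟩, ?_⟩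
  · by_cases hb : G.IsBridge s(x, y)
    · refine ⟨Sum.inr ⟨s(x, y), by simpa using hxy, hb⟩, (hR' _ x y hxy).2 rfl, ?_⟩
      rintro (C | e) hi
      · exact absurd ⟨C.1, C.2, (hR C x y hxy).1 hi⟩ ((hcyc hxy).1 hb)
      · exact congrArg Sum.inr (Subtype.ext ((hR' e x y hxy).1 hi).symm)
    · have := (hcyc hxy).not.1 hb
      push Not at this
      obtain ⟨C, hC, hadj⟩ := this
      refine ⟨Sum.inl ⟨C, hC⟩, (hR ⟨C, hC⟩ x y hxy).2 hadj, ?_⟩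
      rintro (D | e) hi
      · have hD := (hR D x y hxy).1 hi
        exact congrArg Sum.inl (Subtype.ext (hcactus.cycle_unique D.2 hC hxy.ne
          (D.1.edge_vert hD) (C.edge_vert hadj) (D.1.edge_vert hD.symm) (C.edge_vert hadj.symm)))
      · have he := (hR' e x y hxy).1 hi
        exact absurd (he ▸ e.2.2) hb
  · rw [← ht, ← Nat.card_coe_set_eq, Nat.card_eq_fintype_card, card_filter, Fintype.sum_sum_type]
    simp [hℓ]
    rw [Fintype.card_subtype]

end CactusBlocks

/-! ### Comparison of the block contributions -/

section Penalty

lemma blockValue_zero (n t : ℝ) : blockValue n t 0 = 3 * n - 4 + 2 * t := by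
  simp [blockValue, stepMult]
  ring

lemma blockValue_of_ne_zero (n t : ℝ) {ℓ : ℕ} (h : ℓ ≠ 0) : blockValue n t ℓ =
    (((ℓ : ℝ) + 2) ^ 2 - 1) / 3 * (2 * n - ((ℓ : ℝ) + 2) + t - 1) := by
  simp only [blockValue, stepMult, if_neg h]
  ring

/-- The value of `D_R` if all blocks are edges and triangles that share a vertex, the `t` triangles
replacing `2 * t` of the `n - 1` edges of a star. -/
noncomputable def minValue (n t : ℝ) : ℝ :=
  (n - 1) * (3 * n - 4 + 2 * t) + t * (8 / 3 * (2 * n + t - 4) - 2 * (3 * n - 4 + 2 * t))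

/-- The difference between the contributions to `D_R` of a cycle of length `ℓ + 2` and of a triangle
with `ℓ - 1` edges, which has the same numbers of vertices and cycles. It is `0` for an edge
(`ℓ = 0`). -/
noncomputable def penalty (n t : ℝ) (ℓ : ℕ) : ℝ :=
  blockValue n t ℓ - ((ℓ : ℝ) + 1) * (3 * n - 4 + 2 * t) -
    if ℓ ≠ 0 then 8 / 3 * (2 * n + t - 4) - 2 * (3 * n - 4 + 2 * t) else 0

lemma penalty_zero (n t : ℝ) : penalty n t 0 = 0 := by
  simp [penalty, blockValue_zero]

lemma penalty_one (n t : ℝ) : penalty n t 1 = 0 := by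
  simp [penalty, blockValue_of_ne_zero]
  ring

lemma penalty_two (n t : ℝ) : penalty n t 2 = 5 / 3 * n + t / 3 - 31 / 3 := by
  simp [penalty, blockValue_of_ne_zero]
  ring

lemma penalty_of_le_one (n t : ℝ) {ℓ : ℕ} (h : ℓ ≤ 1) : penalty n t ℓ = 0 := by
  interval_cases ℓ
  · exact penalty_zero n t
  · exact penalty_one n t

lemma penalty_two_lt {n t : ℝ} (hn : 7 ≤ n) (ht : 1 ≤ t) {ℓ : ℕ} (h : 3 ≤ ℓ)
    (hℓ : (ℓ : ℝ) + 2 ≤ n) : penalty n t 2 < penalty n t ℓ := by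
  set k : ℝ := (ℓ : ℝ) + 2 with hk
  have hk5 : 5 ≤ k := by
    have : (3 : ℝ) ≤ ℓ := by exact_mod_cast h
    linarith
  -- The difference of the penalties is divisible by `k - 4`.
  have hdiff : penalty n t ℓ - penalty n t 2 =
      (k - 4) / 3 * (n * (2 * k - 1) + t * (k - 2) - k ^ 2 - 5 * k - 7) := by
    have e : (ℓ : ℝ) = k - 2 := by rw [hk]; ring
    rw [penalty_two, penalty, blockValue_of_ne_zero n t (by omega), if_pos (by omega), e]
    ring
  -- For `k ≤ 7` use `7 ≤ n`, otherwise `k ≤ n`.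
  have h1 : 0 < n * (2 * k - 1) + t * (k - 2) - k ^ 2 - 5 * k - 7 := by
    have h2 : (k - 2) ≤ t * (k - 2) := by nlinarith
    by_cases hk7 : k ≤ 7
    · have : 7 * (2 * k - 1) ≤ n * (2 * k - 1) := by nlinarith
      nlinarith
    · have : k * (2 * k - 1) ≤ n * (2 * k - 1) := by nlinarith
      nlinarith
  have h3 : 0 < (k - 4) / 3 := by linarith
  nlinarith [mul_pos h3 h1]

end Penalty

/-! ### The lower bound -/

section Main

variable {V I : Type*} [Fintype V] [Fintype I] {G : SimpleGraph V} {ℓ : I → ℕ}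

lemma BlockFamily.degreeResistance_eq_minValue_add (F : BlockFamily G ℓ) (hG : G.Connected) {t : ℕ}
    (ht : (univ.filter fun i => ℓ i ≠ 0).card = t) :
    degreeResistance G = minValue (Fintype.card V) t +
      ∑ i, (penalty (Fintype.card V) t (ℓ i) + (F.block i).excess) := by
  have hlen := F.sum_length hG
  rw [F.degreeResistance_eq hG ht]
  simp only [penalty, sum_add_distrib, sum_sub_distrib, ← sum_mul]
  simp only [sum_add_distrib] at hlen
  rw [hlen, ← sum_filter, sum_const, ht, nsmul_eq_mul, minValue]
  ring

lemma BlockFamily.card_eq (F : BlockFamily G ℓ) (hG : G.Connected) :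
    ∑ i, (ℓ i + 1) + 1 = Fintype.card V := by
  have hlen := F.sum_length hG
  have : ((∑ i, (ℓ i + 1) + 1 : ℕ) : ℝ) = Fintype.card V := by
    push_cast
    linarith
  exact_mod_cast this

/-- The numbers of edges, triangles and 4-cycles, if there are no longer cycles. -/
lemma BlockFamily.card_filter_eq (F : BlockFamily G ℓ) (hG : G.Connected) (h2 : ∀ i, ℓ i ≤ 2) :
    (univ.filter fun i => ℓ i = 0).card + 2 * (univ.filter fun i => ℓ i = 1).card +
        3 * (univ.filter fun i => ℓ i = 2).card + 1 = Fintype.card V ∧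
      (univ.filter fun i => ℓ i ≠ 0).card =
        (univ.filter fun i => ℓ i = 1).card + (univ.filter fun i => ℓ i = 2).card := by
  rw [← F.card_eq hG]
  simp only [card_filter, mul_sum, ← sum_add_distrib]
  refine ⟨congrArg (· + 1) (sum_congr rfl fun i _ => ?_), sum_congr rfl fun i _ => ?_⟩
  · have := h2 i
    interval_cases ℓ i <;> simp
  · have := h2 i
    interval_cases ℓ i <;> simp

lemma card_filter_lengthsG0 (n t x : ℕ) :
    (univ.filter fun i => lengthsG0 n t i = x).card =
      (if x = 1 then t else 0) + if x = 0 then n - (2 * t + 1) else 0 := by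
  rw [card_filter, Fintype.sum_sum_type]
  show (∑ _ : Fin t, if 1 = x then 1 else 0) + (∑ _ : Fin (n - (2 * t + 1)), if 0 = x then 1 else 0)
    = _
  simp [eq_comm (b := x)]

lemma card_filter_lengthsG5 (n t x : ℕ) :
    (univ.filter fun i => lengthsG5 n t i = x).card =
      (if x = 2 then 1 else 0) + ((if x = 1 then t - 1 else 0) +
        if x = 0 then n - (2 * t + 2) else 0) := by
  rw [card_filter, Fintype.sum_sum_type, Fintype.sum_sum_type]
  show (∑ _ : Unit, if 2 = x then 1 else 0) + ((∑ _ : Fin (t - 1), if 1 = x then 1 else 0) +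
    (∑ _ : Fin (n - (2 * t + 2)), if 0 = x then 1 else 0)) = _
  simp [eq_comm (b := x)]

lemma BlockFamily.nonempty_iso_graphG0 (F : BlockFamily G ℓ) (hG : G.Connected) {t : ℕ}
    (ht1 : 1 ≤ t) (ht : (univ.filter fun i => ℓ i ≠ 0).card = t) (h1 : ∀ i, ℓ i ≤ 1)
    (hend : ∀ i, (F.block i).IsEnd) : Nonempty (G ≃g graphG0 (Fintype.card V) t) := by
  have hne : Nonempty I := by
    obtain ⟨i, -⟩ := card_pos.1 (ht.symm ▸ ht1 : 0 < (univ.filter fun i => ℓ i ≠ 0).card)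
    exact ⟨i⟩
  obtain ⟨hc1, hc2⟩ := F.card_filter_eq hG fun i => (h1 i).trans one_le_two
  have hc3 : (univ.filter fun i => ℓ i = 2).card = 0 :=
    card_eq_zero.2 (filter_eq_empty_iff.2 fun i _ => by have := h1 i; omega)
  refine (F.isFlower hG hend).nonempty_iso_of_card (isFlower_graphG0 _ t ht1) fun x => ?_
  rw [card_filter_lengthsG0]
  rcases x with _ | _ | x
  · simp only [if_true, zero_ne_one, if_false]; omega
  · simp only [zero_add, if_true, one_ne_zero, if_false]; omega
  · have : (univ.filter fun i => ℓ i = x + 1 + 1).card = 0 :=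
      card_eq_zero.2 (filter_eq_empty_iff.2 fun i _ => by have := h1 i; omega)
    simp [this]

lemma BlockFamily.nonempty_iso_graphG5 (F : BlockFamily G ℓ) (hG : G.Connected) {t : ℕ}
    (ht : (univ.filter fun i => ℓ i ≠ 0).card = t) {o : I} (ho : ℓ o = 2)
    (h1 : ∀ i, i ≠ o → ℓ i ≤ 1) (hend : ∀ i, (F.block i).IsEnd) :
    2 * t + 2 ≤ Fintype.card V ∧ Nonempty (G ≃g graphG5 (Fintype.card V) t) := by
  have hne : Nonempty I := ⟨o⟩
  have h2 : ∀ i, ℓ i ≤ 2 := fun i => by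
    by_cases hi : i = o
    · rw [hi, ho]
    · exact (h1 i hi).trans one_le_two
  obtain ⟨hc1, hc2⟩ := F.card_filter_eq hG h2
  have hc3 : (univ.filter fun i => ℓ i = 2).card = 1 := by
    refine card_eq_one.2 ⟨o, ?_⟩
    ext i
    rw [mem_filter, mem_singleton]
    refine ⟨fun hi => ?_, fun hi => ⟨mem_univ _, by rw [hi, ho]⟩⟩
    by_contra hne
    have := h1 i hne
    omega
  refine ⟨by omega, (F.isFlower hG hend).nonempty_iso_of_card (isFlower_graphG5 _ t) fun x => ?_⟩
  rw [card_filter_lengthsG5]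
  rcases x with _ | _ | _ | x
  · simp; omega
  · simp; omega
  · simp [hc3]
  · have : (univ.filter fun i => ℓ i = x + 1 + 1 + 1).card = 0 :=
      card_eq_zero.2 (filter_eq_empty_iff.2 fun i _ => by have := h2 i; omega)
    simp [this]

lemma degreeResistance_of_iso_graphG5 {n t : ℕ} (hG : G.Connected) (hV : Fintype.card V = n)
    (ht : 1 ≤ t) (e : G ≃g graphG5 n t) :
    degreeResistance G = minValue n t + penalty n t 2 := by
  obtain ⟨F, hF⟩ := ((isFlower_graphG5 n t).of_iso e).exists_blockFamily
  have hcard : (univ.filter fun i => lengthsG5 n t i ≠ 0).card = t := by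
    rw [card_filter, Fintype.sum_sum_type, Fintype.sum_sum_type]
    show (∑ _ : Unit, if 2 ≠ 0 then 1 else 0) + ((∑ _ : Fin (t - 1), if 1 ≠ 0 then 1 else 0) +
      (∑ _ : Fin (n - (2 * t + 2)), if 0 ≠ 0 then 1 else 0)) = _
    simp
    omega
  have hsum : ∑ i, (penalty n t (lengthsG5 n t i) + (F.block i).excess) =
      ∑ i, penalty n t (lengthsG5 n t i) :=
    sum_congr rfl fun i _ => by rw [(hF i).excess_eq_zero, add_zero]
  rw [F.degreeResistance_eq_minValue_add hG hcard, hV, hsum, Fintype.sum_sum_type,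
    Fintype.sum_sum_type]
  show _ + ((∑ _ : Unit, penalty n t 2) + ((∑ _ : Fin (t - 1), penalty n t 1) +
      (∑ _ : Fin (n - (2 * t + 2)), penalty n t 0))) = _
  simp [penalty_zero, penalty_one]

/-- A block that is an edge or a triangle and not an end block costs more than a 4-cycle. -/
lemma penalty_two_lt_excess {l : ℕ} (R : Retract G l) (hG : G.Connected) (hl : l ≤ 1) {t : ℝ}
    (ht : 2 * t ≤ (Fintype.card V : ℝ) - 1) (hR : ¬ R.IsEnd) :
    penalty (Fintype.card V) t 2 < R.excess := by
  obtain ⟨h1, h2⟩ := R.le_excess_of_not_isEnd hG hR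
  refine lt_of_lt_of_le ?_ h2
  rw [penalty_two, blockRes_one]
  interval_cases l
  · norm_num [stepMult] at h1 ⊢
    linarith
  · norm_num [stepMult] at h1 ⊢
    linarith

theorem BlockFamily.minValue_add_penalty_le (F : BlockFamily G ℓ) (hG : G.Connected) {t : ℕ}
    (hn : 7 ≤ Fintype.card V) (ht1 : 1 ≤ t) (ht : (univ.filter fun i => ℓ i ≠ 0).card = t)
    (hG0 : ¬ Nonempty (G ≃g graphG0 (Fintype.card V) t)) :
    minValue (Fintype.card V) t + penalty (Fintype.card V) t 2 ≤ degreeResistance G ∧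
      (degreeResistance G = minValue (Fintype.card V) t + penalty (Fintype.card V) t 2 →
        2 * t + 2 ≤ Fintype.card V ∧ Nonempty (G ≃g graphG5 (Fintype.card V) t)) := by
  rw [F.degreeResistance_eq_minValue_add hG ht]
  set N : ℝ := ((Fintype.card V : ℕ) : ℝ) with hN
  have hN7 : 7 ≤ N := by rw [hN]; exact_mod_cast hn
  have hT1 : (1 : ℝ) ≤ t := by exact_mod_cast ht1
  have hlen : ∀ i, (ℓ i : ℝ) + 2 ≤ N := by
    intro i
    have h1 := F.card_eq hG
    have h2 := single_le_sum (f := fun i => ℓ i + 1) (fun i _ => Nat.zero_le _) (mem_univ i)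
    have h3 : ℓ i + 2 ≤ Fintype.card V := by
      omega
    rw [hN]
    exact_mod_cast h3
  have hδ : 0 < penalty N t 2 := by rw [penalty_two]; linarith
  have hpen : ∀ i, 2 ≤ ℓ i → penalty N t 2 ≤ penalty N t (ℓ i) := by
    intro i hi
    rcases hi.eq_or_lt with h | h
    · rw [← h]
    · exact (penalty_two_lt hN7 hT1 h (hlen i)).le
  have hpen0 : ∀ i, 0 ≤ penalty N t (ℓ i) := by
    intro i
    by_cases hi : ℓ i ≤ 1
    · rw [penalty_of_le_one _ _ hi]
    · exact hδ.le.trans (hpen i (by omega))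
  have hterm : ∀ i, 0 ≤ penalty N t (ℓ i) + (F.block i).excess := fun i =>
    add_nonneg (hpen0 i) ((F.block i).excess_nonneg hG)
  by_cases hsmall : ∀ i, ℓ i ≤ 1
  · have hex : ∃ i, ¬ (F.block i).IsEnd := by
      by_contra! h
      exact hG0 (F.nonempty_iso_graphG0 hG ht1 ht hsmall h)
    obtain ⟨i, hi⟩ := hex
    have h2t : 2 * (t : ℝ) ≤ N - 1 := by
      obtain ⟨hc1, hc2⟩ := F.card_filter_eq hG fun i => (hsmall i).trans one_le_two
      have : 2 * t + 1 ≤ Fintype.card V := by omega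
      have : 2 * (t : ℝ) + 1 ≤ N := by rw [hN]; exact_mod_cast this
      linarith
    have h1 := penalty_two_lt_excess (F.block i) hG (hsmall i) h2t hi
    have h2 := single_le_sum (f := fun i => penalty N t (ℓ i) + (F.block i).excess)
      (fun i _ => hterm i) (mem_univ i)
    have h3 := hpen0 i
    constructor
    · linarith
    · intro h
      linarith
  · push Not at hsmall
    obtain ⟨o, ho⟩ := hsmall
    have ho2 := hpen o ho
    have hoe := (F.block o).excess_nonneg hG
    have hsplit := add_sum_erase univ (fun i => penalty N t (ℓ i) + (F.block i).excess)
      (mem_univ o)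
    have hrest : 0 ≤ ∑ i ∈ univ.erase o, (penalty N t (ℓ i) + (F.block i).excess) :=
      sum_nonneg fun i _ => hterm i
    refine ⟨by linarith, fun h => ?_⟩
    have hrest0 : ∑ i ∈ univ.erase o, (penalty N t (ℓ i) + (F.block i).excess) = 0 := by linarith
    have hoe0 : (F.block o).excess = 0 := by linarith
    have ho2' : penalty N t (ℓ o) = penalty N t 2 := by linarith
    have hzero : ∀ i, i ≠ o → penalty N t (ℓ i) + (F.block i).excess = 0 := fun i hi =>
      (sum_eq_zero_iff_of_nonneg fun i _ => hterm i).1 hrest0 i (mem_erase.2 ⟨hi, mem_univ i⟩)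
    have hlo : ℓ o = 2 := by
      rcases (show 2 ≤ ℓ o from ho).eq_or_lt with h | h
      · exact h.symm
      · exact absurd ho2' (penalty_two_lt hN7 hT1 h (hlen o)).ne'
    refine F.nonempty_iso_graphG5 hG ht hlo (fun i hi => ?_) fun i => ?_
    · by_contra hcon
      have h1 := hpen i (by omega)
      have h2 := hzero i hi
      have h3 := (F.block i).excess_nonneg hG
      linarith
    · by_cases hi : i = o
      · rw [hi]
        exact (F.block o).isEnd_of_excess_eq_zero hG hoe0
      · have h1 := hpen0 i
        have h2 := hzero i hi
        have h3 := (F.block i).excess_nonneg hG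
        exact (F.block i).isEnd_of_excess_eq_zero hG (by linarith)

end Main

end DegreeResistance

theorem corollary4p2 {V : Type*} [Fintype V] (n t : ℕ) (hn : 7 ≤ n) (ht : 1 ≤ t)
    (G : SimpleGraph V) (hG : DegreeResistance.IsCact n t G)
    (hG0 : ¬ Nonempty (G ≃g DegreeResistance.graphG0 n t)) :
    -(4 / 3 : ℝ) * (t : ℝ) ^ 2 + ((4 / 3 : ℝ) * (n : ℝ) - 13 / 3) * (t : ℝ) + 3 * (n : ℝ) ^ 2
        - (16 / 3 : ℝ) * (n : ℝ) - 19 / 3 ≤ DegreeResistance.degreeResistance G ∧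
    (DegreeResistance.degreeResistance G =
        -(4 / 3 : ℝ) * (t : ℝ) ^ 2 + ((4 / 3 : ℝ) * (n : ℝ) - 13 / 3) * (t : ℝ) + 3 * (n : ℝ) ^ 2
          - (16 / 3 : ℝ) * (n : ℝ) - 19 / 3 ↔
      2 * t + 2 ≤ n ∧ Nonempty (G ≃g DegreeResistance.graphG5 n t)) := by
  have hbound : -(4 / 3 : ℝ) * (t : ℝ) ^ 2 + ((4 / 3 : ℝ) * (n : ℝ) - 13 / 3) * (t : ℝ)
      + 3 * (n : ℝ) ^ 2 - (16 / 3 : ℝ) * (n : ℝ) - 19 / 3 =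
      DegreeResistance.minValue n t + DegreeResistance.penalty n t 2 := by
    rw [DegreeResistance.penalty_two, DegreeResistance.minValue]
    ring
  rw [hbound]
  have hconn := hG.1.1
  have hV := hG.2.1
  obtain ⟨I, _, ℓ, F, hcard⟩ := hG.exists_blockFamily
  subst hV
  obtain ⟨h1, h2⟩ := F.minValue_add_penalty_le hconn hn ht hcard hG0
  exact ⟨h1, h2, fun ⟨_, ⟨e⟩⟩ =>
    DegreeResistance.degreeResistance_of_iso_graphG5 hconn rfl ht e⟩
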